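/- Let $0<\alpha<1$, $L>0$, and let $\varphi\in C^1(\mathbb{R})$ be $L$-periodic and strictly positive, with $\int_0^L\varphi(s)\,ds=1$ and $$\max_{[0,L]}\left|\frac{\varphi'(s)}{\varphi^2(s)}\right|\le 2\pi .$$ Put $\Phi(s)=2\pi\int_0^s\varphi(\sigma)\,d\sigma$, let $s(t)=\Phi^{-1}(t)$ be its inverse function, and let $$R=\left|\int_0^1\exp\left\{\frac1{2\pi}\int_0^{2\pi}\frac{e^{i\tau}+t}{e^{i\tau}-t}\,\log\frac1{2\pi\varphi(s(\tau))}\,d\tau\right\}dt\right|.$$ Then $R>0$, and for all $\zeta_c,\zeta_b\in\mathbb{C}$ with $|\zeta_b-\zeta_c|=R$ there is a bounded simply connected domain $\Omega\subset\mathbb{C}$ of class $C^{1,\alpha}$ with $\zeta_c\in\Omega$ and $\zeta_b\in\partial\Omega$, whose boundary is a simple closed curve of length $L$, such that the Green's function $U$ of $\Omega$ with pole $\zeta_c$ (the solution of $-\Delta U=\delta_{\zeta_c}$ in $\Omega$, $U=0$ on $\partial\Omega$) has interior normal derivative $$\frac{\partial U}{\partial\nu}=\varphi\quad\text{on }\partial\Omega,$$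 where $\varphi$ is regarded as a function of the arclength on $\partial\Omega$, measured counterclockwise from $\zeta_b$. In other words, $\varphi$ is in the range of the operator $\mathcal T$ which maps each such domain to the interior normal derivative of its Green's function. -/

import Mathlib

open Set Filter Topology MeasureTheory
open scoped NNReal ContDiff

noncomputable section

/-- `Ω` is (locally) a domain of class `C^{1,α}`: near each boundary point `p`, in suitable
Cartesian coordinates `(x, y)` centred at `p` (the point with coordinates `(x, y)` being
`p + (x + i y) e` with `|e| = 1`), `Ω` is the strict epigraph of a function `g` whose derivative
is Hölder continuous with exponent `α`. -/
def IsC1HolderDomain (α : ℝ≥0) (Ω : Set ℂ) : Prop :=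
  ∀ p ∈ frontier Ω, ∃ (e : ℂ) (δ η : ℝ) (g : ℝ → ℝ) (C : ℝ≥0),
    ‖e‖ = 1 ∧ 0 < δ ∧ 0 < η ∧
    (∀ x ∈ Ioo (-δ) δ, DifferentiableAt ℝ g x) ∧
    HolderOnWith C α (deriv g) (Ioo (-δ) δ) ∧
    ∀ x ∈ Ioo (-δ) δ, ∀ y ∈ Ioo (-η) η,
      (p + ((x : ℂ) + (y : ℂ) * Complex.I) * e ∈ Ω ↔ g x < y)

/-- The class `𝒪` of all bounded simply connected domains `Ω` of class `C^{1,α}` with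
`ζc ∈ Ω` and `ζb ∈ ∂Ω`. -/
structure DomainClass (α : ℝ≥0) (ζc ζb : ℂ) (Ω : Set ℂ) : Prop where
  isOpen : IsOpen Ω
  simplyConnected : IsSimplyConnected Ω
  bounded : Bornology.IsBounded Ω
  regular : IsC1HolderDomain α Ω
  pole_mem : ζc ∈ Ω
  base_mem : ζb ∈ frontier Ω

/-- `U` is the Green's function of `Ω` with pole `ζc`: `-ΔU = δ_{ζc}` in `Ω` in the sense of
distributions, and `U` is continuous up to the boundary, where it vanishes. -/
structure IsGreenFunction (Ω : Set ℂ) (ζc : ℂ) (U : ℂ → ℝ) : Prop where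
  continuousOn : ContinuousOn U (closure Ω \ {ζc})
  boundary : ∀ ζ ∈ frontier Ω, U ζ = 0
  locallyIntegrable : LocallyIntegrableOn U Ω
  neg_laplacian_eq_dirac : ∀ ψ : ℂ → ℝ, ContDiff ℝ ∞ ψ → HasCompactSupport ψ → tsupport ψ ⊆ Ω →
    -(∫ ζ in Ω, U ζ * Laplacian.laplacian ψ ζ) = ψ ζc

/-- `σ` is the parametrization of `∂Ω` by arclength, measured counterclockwise (that is, with `Ω`
on the left) from `ζb`, extended periodically; `∂Ω` is a simple closed curve of length `L`.
The interior unit normal at `σ s` is `i σ'(s)`. -/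
structure IsArclengthParam (Ω : Set ℂ) (ζb : ℂ) (L : ℝ) (σ : ℝ → ℂ) : Prop where
  contDiff : ContDiff ℝ 1 σ
  unitSpeed : ∀ s, ‖deriv σ s‖ = 1
  periodic : Function.Periodic σ L
  injOn : InjOn σ (Ico 0 L)
  image_eq : σ '' Ico 0 L = frontier Ω
  base : σ 0 = ζb
  left : ∀ s, ∀ᶠ t : ℝ in 𝓝[>] 0, σ s + (t : ℂ) * (Complex.I * deriv σ s) ∈ Ω

/-- `𝒯(Ω) = φ`: the boundary of `Ω` has length `L`, and `φ` is the interior normal derivative of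
the Green's function of `Ω` with pole `ζc`, as a function of the arclength measured
counterclockwise on `∂Ω` from `ζb`. -/
def ForwardOperatorEq (ζc ζb : ℂ) (Ω : Set ℂ) (L : ℝ) (φ : ℝ → ℝ) : Prop :=
  ∃ (U : ℂ → ℝ) (σ : ℝ → ℂ), IsGreenFunction Ω ζc U ∧ IsArclengthParam Ω ζb L σ ∧
    ∀ s : ℝ, HasDerivWithinAt
      (fun t : ℝ => U (σ s + (t : ℂ) * (Complex.I * deriv σ s))) (φ s) (Ici 0) 0

/-- `Φ(s) = 2π ∫₀ˢ φ`. -/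
def Phi (φ : ℝ → ℝ) (s : ℝ) : ℝ := 2 * Real.pi * ∫ x in (0 : ℝ)..s, φ x

/-- `s(θ) = Φ⁻¹(θ)`; for `φ` continuous, periodic and positive, `Φ` is a bijection of `ℝ`. -/
def arclengthOf (φ : ℝ → ℝ) : ℝ → ℝ := Function.invFun (Phi φ)

/-- The function
`exp { (1/2π) ∫₀^{2π} (e^{it} + z)/(e^{it} - z) log (1 / (2π φ(s(t)))) dt }` of `z` in the disk. -/
def outerFunction (φ : ℝ → ℝ) (z : ℂ) : ℂ :=
  Complex.exp ((1 / (2 * Real.pi) : ℂ) * ∫ t in (0 : ℝ)..(2 * Real.pi),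
    (Complex.exp (t * Complex.I) + z) / (Complex.exp (t * Complex.I) - z) *
      (Real.log (1 / (2 * Real.pi * φ (arclengthOf φ t))) : ℂ))

/-- The distance between the pole and the reference boundary point that `φ` dictates:
the modulus of `∫₀¹ exp {…} dt` along the radius from `0` to `1`. -/
def poleDistance (φ : ℝ → ℝ) : ℝ := ‖∫ t in (0 : ℝ)..1, outerFunction φ (t : ℂ)‖

end

/-! If `f` maps the unit disk conformally onto `Ω` with `f 0 = ζc`, the Green's function is `-(1/2π)
log |f⁻¹|`, and its interior normal derivative at `f(e^{it})` is `1 / (2π |f'(e^{it})|)`. For this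
to equal `φ` in arclength, `ds = |f'| dt` forces `t = Φ(s)` and `log |f'(e^{it})| = h(t)` with `h(t)
= log (1 / (2π φ(s(t))))`. So `log f'` has to be the Schwarz integral `S` of `h` up to an imaginary
constant, which amounts to a rotation of `Ω`. What remains is to show that a primitive `f` of `F =
exp S` is injective and regular up to the circle.

This is where the bound on `φ'/φ²` enters: `h' = -φ'/(2πφ²)`, so `h` is 1-Lipschitz
(`lipschitzWith_logDensity`). The conjugate function of such a density is at most `1 + π/8 < π/2` in
absolute value (`abs_im_schwarzIntegral_le`), hence `Re F = e^{Re S} cos (Im S)` is bounded below by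
a positive constant on the closed disk, and the Noshiro–Warschawski argument makes `f` univalent
there (`isDiskChart_of_le_re`). The Lipschitz bound also gives `|S'| ≤ K (1 - |z|)^{β-1}` for every
`β < 1`, hence a Hölder extension of `S` to the closed disk with any exponent below 1
(`exists_extension_schwarzIntegral`).

The geometry rests on the structure `IsDiskChart`: a jointly continuous difference quotient `A z w`,
bounded away from zero. Injectivity, one-sided derivatives of `f` and of its inverse, and the
description of the frontier follow from it almost algebraically. From it `exists_epigraph` derives
`C^{1,α}` regularity, `isGreenFunction` the Green's function (the conformal pull-back of the
logarithm), and `hasDerivWithinAt_green_normal` its normal derivative. A rigid motion finally places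
`f 0` and `f 1` at `ζc` and `ζb`; this is possible because `|f 1 - f 0|` is the prescribed distance.
-/

/-! ### The Schwarz integral inside the disk -/

/-- The Schwarz integral over the unit circle of a real density `h`, given as a function of the
angle. -/
noncomputable def schwarzIntegral (h : ℝ → ℝ) (z : ℂ) : ℂ :=
  (1 / (2 * Real.pi) : ℂ) * ∫ t in (0 : ℝ)..(2 * Real.pi),
    (Complex.exp (t * Complex.I) + z) / (Complex.exp (t * Complex.I) - z) * (h t : ℂ)

/-- The derivative of `schwarzIntegral h` in the open unit disk. -/
noncomputable def schwarzIntegralDeriv (h : ℝ → ℝ) (z : ℂ) : ℂ :=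
  (1 / (2 * Real.pi) : ℂ) * ∫ t in (0 : ℝ)..(2 * Real.pi),
    2 * Complex.exp (t * Complex.I) / (Complex.exp (t * Complex.I) - z) ^ 2 * (h t : ℂ)

lemma one_sub_norm_le_norm_exp_sub (t : ℝ) (z : ℂ) :
    1 - ‖z‖ ≤ ‖Complex.exp (t * Complex.I) - z‖ := by
  have := norm_sub_norm_le (Complex.exp (t * Complex.I)) z
  rwa [Complex.norm_exp_ofReal_mul_I] at this

lemma exp_sub_ne_zero {z : ℂ} (hz : ‖z‖ < 1) (t : ℝ) : Complex.exp (t * Complex.I) - z ≠ 0 := by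
  have := one_sub_norm_le_norm_exp_sub t z
  exact norm_pos_iff.mp (by linarith)

lemma continuous_schwarz_integrand {h : ℝ → ℝ} (hh : Continuous h) {z : ℂ} (hz : ‖z‖ < 1) :
    Continuous fun t : ℝ => (Complex.exp (t * Complex.I) + z) / (Complex.exp (t * Complex.I) - z)
      * (h t : ℂ) :=
  (Continuous.div (by fun_prop) (by fun_prop) (exp_sub_ne_zero hz)).mul (by fun_prop)

lemma continuous_schwarzDeriv_integrand {h : ℝ → ℝ} (hh : Continuous h) {z : ℂ} (hz : ‖z‖ < 1) :
    Continuous fun t : ℝ =>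
      2 * Complex.exp (t * Complex.I) / (Complex.exp (t * Complex.I) - z) ^ 2 * (h t : ℂ) :=
  (Continuous.div (by fun_prop) (by fun_prop) fun t => pow_ne_zero 2 (exp_sub_ne_zero hz t)).mul
    (by fun_prop)

lemma hasDerivAt_schwarzIntegral {h : ℝ → ℝ} (hh : Continuous h) {z : ℂ} (hz : ‖z‖ < 1) :
    HasDerivAt (schwarzIntegral h) (schwarzIntegralDeriv h z) z := by
  obtain ⟨M, hM⟩ := (isCompact_uIcc (a := (0 : ℝ)) (b := 2 * Real.pi)).exists_bound_of_continuousOn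
    hh.continuousOn
  have hr : 0 < (1 - ‖z‖) / 2 := by linarith
  have hball : ∀ w ∈ Metric.ball z ((1 - ‖z‖) / 2), (1 - ‖z‖) / 2 ≤ 1 - ‖w‖ := by
    intro w hw
    rw [mem_ball_iff_norm] at hw
    have := norm_sub_norm_le w z
    linarith
  have hlt : ∀ w ∈ Metric.ball z ((1 - ‖z‖) / 2), ‖w‖ < 1 := fun w hw => by
    have := hball w hw; linarith
  refine HasDerivAt.const_mul _ (intervalIntegral.hasDerivAt_integral_of_dominated_loc_of_deriv_le
    (F := fun (z : ℂ) (t : ℝ) => (Complex.exp (t * Complex.I) + z) /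
      (Complex.exp (t * Complex.I) - z) * (h t : ℂ))
    (F' := fun (z : ℂ) (t : ℝ) => 2 * Complex.exp (t * Complex.I) /
      (Complex.exp (t * Complex.I) - z) ^ 2 * (h t : ℂ))
    (bound := fun _ => 2 / ((1 - ‖z‖) / 2) ^ 2 * M)
    (s := Metric.ball z ((1 - ‖z‖) / 2)) (Metric.ball_mem_nhds _ hr) ?_ ?_ ?_ ?_ ?_ ?_).2
  · filter_upwards [Metric.ball_mem_nhds z hr] with w hw
    exact (continuous_schwarz_integrand hh (hlt w hw)).aestronglyMeasurable
  · exact (continuous_schwarz_integrand hh hz).intervalIntegrable _ _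
  · exact (continuous_schwarzDeriv_integrand hh hz).aestronglyMeasurable
  · refine Eventually.of_forall fun t ht w hw => ?_
    rw [norm_mul, norm_div, norm_mul, norm_pow, Complex.norm_exp_ofReal_mul_I, Complex.norm_real]
    have h1 := (hball w hw).trans (one_sub_norm_le_norm_exp_sub t w)
    have h2 := hM t (uIoc_subset_uIcc ht)
    simp only [RCLike.norm_ofNat, mul_one]
    gcongr
  · exact intervalIntegrable_const
  · refine Eventually.of_forall fun t _ w hw => ?_
    have hne := exp_sub_ne_zero (hlt w hw) t
    refine ((((hasDerivAt_id' w).const_add (Complex.exp (t * Complex.I))).fun_div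
      ((hasDerivAt_id' w).const_sub (Complex.exp (t * Complex.I))) hne).mul_const
      (h t : ℂ)).congr_deriv ?_
    congr 2
    ring

lemma differentiableOn_schwarzIntegral {h : ℝ → ℝ} (hh : Continuous h) :
    DifferentiableOn ℂ (schwarzIntegral h) (Metric.ball 0 1) := fun _ hz =>
  (hasDerivAt_schwarzIntegral hh (mem_ball_zero_iff.mp hz)).differentiableAt.differentiableWithinAt

/-- The differentiated kernel has the `2π`-periodic primitive `2i / (e^{it} - z)` in `t`. -/
lemma schwarzIntegralDeriv_one {z : ℂ} (hz : ‖z‖ < 1) : schwarzIntegralDeriv (fun _ => 1) z = 0 := by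
  have hd : ∀ t ∈ uIcc (0 : ℝ) (2 * Real.pi),
      HasDerivAt (fun t : ℝ => 2 * Complex.I / (Complex.exp (t * Complex.I) - z))
        (2 * Complex.exp (t * Complex.I) / (Complex.exp (t * Complex.I) - z) ^ 2 * ((1 : ℝ) : ℂ))
        t := by
    intro t _
    have h0 : HasDerivAt (fun t : ℝ => Complex.exp (t * Complex.I) - z)
        (Complex.exp (t * Complex.I) * (1 * Complex.I)) t :=
      (((Complex.ofRealCLM.hasDerivAt (x := t)).mul_const Complex.I).cexp).sub_const z
    refine ((hasDerivAt_const t (2 * Complex.I)).fun_div h0 (exp_sub_ne_zero hz t)).congr_deriv ?_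
    rw [Complex.ofReal_one, mul_one]
    congr 1
    linear_combination -2 * Complex.exp (t * Complex.I) * Complex.I_sq
  rw [schwarzIntegralDeriv, intervalIntegral.integral_eq_sub_of_hasDerivAt hd
    ((continuous_schwarzDeriv_integrand continuous_const hz).intervalIntegrable _ _)]
  simp

lemma schwarzIntegral_one {z : ℂ} (hz : ‖z‖ < 1) : schwarzIntegral (fun _ => 1) z = 1 := by
  have h0 : schwarzIntegral (fun _ => 1) 0 = 1 := by
    have : (Real.pi : ℂ) ≠ 0 := by exact_mod_cast Real.pi_ne_zero
    simp [schwarzIntegral]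
    field_simp
  rw [← h0]
  refine Metric.isOpen_ball.is_const_of_deriv_eq_zero (convex_ball (0 : ℂ) 1).isPreconnected
    (differentiableOn_schwarzIntegral continuous_const) ?_ (mem_ball_zero_iff.mpr hz)
    (Metric.mem_ball_self one_pos)
  intro w hw
  rw [(hasDerivAt_schwarzIntegral continuous_const (mem_ball_zero_iff.mp hw)).deriv]
  exact schwarzIntegralDeriv_one (mem_ball_zero_iff.mp hw)

/-- Constants are reproduced. With `c = h θ` the density vanishes at the angle `θ`, which tames the
kernel as the point approaches `e^{iθ}`. -/
lemma schwarzIntegral_sub_const {h : ℝ → ℝ} (hh : Continuous h) (c : ℝ) {z : ℂ} (hz : ‖z‖ < 1) :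
    schwarzIntegral h z - c = schwarzIntegral (fun t => h t - c) z := by
  have h1 := schwarzIntegral_one hz
  unfold schwarzIntegral at h1 ⊢
  have : ∀ t : ℝ, (Complex.exp (t * Complex.I) + z) / (Complex.exp (t * Complex.I) - z)
      * ((h t - c : ℝ) : ℂ) = (Complex.exp (t * Complex.I) + z) / (Complex.exp (t * Complex.I) - z)
      * (h t : ℂ) - (Complex.exp (t * Complex.I) + z) / (Complex.exp (t * Complex.I) - z)
      * ((1 : ℝ) : ℂ) * (c : ℂ) := fun t => by push_cast; ring
  simp_rw [this]
  rw [intervalIntegral.integral_sub ((continuous_schwarz_integrand hh hz).intervalIntegrable _ _)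
    (((continuous_schwarz_integrand (h := fun _ => 1) continuous_const hz).intervalIntegrable
      _ _).mul_const (c : ℂ)), intervalIntegral.integral_mul_const, mul_sub, ← mul_assoc _ _ (c : ℂ), h1, one_mul]

lemma schwarzIntegralDeriv_eq_sub_const {h : ℝ → ℝ} (hh : Continuous h) (c : ℝ) {z : ℂ}
    (hz : ‖z‖ < 1) :
    schwarzIntegralDeriv h z = schwarzIntegralDeriv (fun t => h t - c) z := by
  have h1 := schwarzIntegralDeriv_one hz
  unfold schwarzIntegralDeriv at h1 ⊢
  have : ∀ t : ℝ, 2 * Complex.exp (t * Complex.I) / (Complex.exp (t * Complex.I) - z) ^ 2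
      * ((h t - c : ℝ) : ℂ) = 2 * Complex.exp (t * Complex.I) / (Complex.exp (t * Complex.I) - z) ^ 2
      * (h t : ℂ) - 2 * Complex.exp (t * Complex.I) / (Complex.exp (t * Complex.I) - z) ^ 2
      * ((1 : ℝ) : ℂ) * (c : ℂ) := fun t => by push_cast; ring
  simp_rw [this]
  rw [intervalIntegral.integral_sub
    ((continuous_schwarzDeriv_integrand hh hz).intervalIntegrable _ _)
    (((continuous_schwarzDeriv_integrand (h := fun _ => 1) continuous_const hz).intervalIntegrable
      _ _).mul_const (c : ℂ)),
    intervalIntegral.integral_mul_const, mul_sub, ← mul_assoc _ _ (c : ℂ), h1, zero_mul, sub_zero]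

lemma Function.Periodic.intervalIntegral_eq_integral_add {g : ℝ → ℂ}
    (hg : Function.Periodic g (2 * Real.pi)) (θ : ℝ) :
    ∫ t in (0 : ℝ)..(2 * Real.pi), g t = ∫ τ in (-Real.pi)..Real.pi, g (τ + θ) := by
  rw [intervalIntegral.integral_comp_add_right]
  have := hg.intervalIntegral_add_eq 0 (-Real.pi + θ)
  rw [zero_add] at this
  rw [this]
  congr 1
  ring

lemma exp_ofReal_mul_I_periodic :
    Function.Periodic (fun t : ℝ => Complex.exp (t * Complex.I)) (2 * Real.pi) := by
  intro t
  simp only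
  push_cast
  rw [add_mul, Complex.exp_add, Complex.exp_two_pi_mul_I, mul_one]

/-- The rotation `t = τ + θ` puts the near-singularity of the kernel at `τ = 0`, in the middle of
the interval of integration. -/
lemma schwarzIntegral_polar {h : ℝ → ℝ} (hper : Function.Periodic h (2 * Real.pi)) (r θ : ℝ) :
    schwarzIntegral h (r * Complex.exp (θ * Complex.I)) =
      (1 / (2 * Real.pi) : ℂ) * ∫ τ in (-Real.pi)..Real.pi,
        (Complex.exp (τ * Complex.I) + r) / (Complex.exp (τ * Complex.I) - r)
          * (h (τ + θ) : ℂ) := by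
  rw [schwarzIntegral, Function.Periodic.intervalIntegral_eq_integral_add (θ := θ)]
  · congr 2
    ext τ
    have : Complex.exp ((τ + θ : ℝ) * Complex.I) =
        Complex.exp (τ * Complex.I) * Complex.exp (θ * Complex.I) := by
      rw [← Complex.exp_add]; push_cast; ring_nf
    rw [this, ← add_mul, ← sub_mul, mul_div_mul_right _ _ (Complex.exp_ne_zero _)]
  · intro t
    have := exp_ofReal_mul_I_periodic t
    simp only at this ⊢
    rw [this, hper t]

lemma schwarzIntegralDeriv_polar {h : ℝ → ℝ} (hper : Function.Periodic h (2 * Real.pi)) (r θ : ℝ) :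
    schwarzIntegralDeriv h (r * Complex.exp (θ * Complex.I)) =
      Complex.exp (-(θ * Complex.I)) * ((1 / (2 * Real.pi) : ℂ) * ∫ τ in (-Real.pi)..Real.pi,
        2 * Complex.exp (τ * Complex.I) / (Complex.exp (τ * Complex.I) - r) ^ 2
          * (h (τ + θ) : ℂ)) := by
  rw [schwarzIntegralDeriv, Function.Periodic.intervalIntegral_eq_integral_add (θ := θ)]
  · rw [mul_left_comm]
    congr 1
    rw [← intervalIntegral.integral_const_mul]
    congr 1
    ext τ
    have : Complex.exp ((τ + θ : ℝ) * Complex.I) =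
        Complex.exp (τ * Complex.I) * Complex.exp (θ * Complex.I) := by
      rw [← Complex.exp_add]; push_cast; ring_nf
    rw [this, ← sub_mul, mul_pow, Complex.exp_neg, ← mul_assoc _ _ ((h (τ + θ) : ℝ) : ℂ), pow_two
      (Complex.exp (θ * Complex.I)), ← mul_assoc 2, ← mul_assoc (_ ^ 2),
      mul_div_mul_right _ _ (Complex.exp_ne_zero _), div_mul_eq_div_div, div_eq_inv_mul _
      (Complex.exp (θ * Complex.I))]
  · intro t
    have := exp_ofReal_mul_I_periodic t
    simp only at this ⊢
    rw [this, hper t]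

/-! ### Kernel estimates and radial boundary values -/

lemma norm_exp_sub_one_le_two_mul {r : ℝ} (hr0 : 0 ≤ r) (hr1 : r < 1) (τ : ℝ) :
    ‖Complex.exp (τ * Complex.I) - 1‖ ≤ 2 * ‖Complex.exp (τ * Complex.I) - r‖ := by
  have h1 : ‖(r : ℂ) - 1‖ ≤ ‖Complex.exp (τ * Complex.I) - r‖ := by
    have e : (r : ℂ) - 1 = ((r - 1 : ℝ) : ℂ) := by push_cast; ring
    have h2 := one_sub_norm_le_norm_exp_sub τ r
    rw [e, Complex.norm_real, Real.norm_eq_abs, abs_of_neg (by linarith)]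
    rw [Complex.norm_real, Real.norm_eq_abs, abs_of_nonneg hr0] at h2
    linarith
  have := norm_sub_le_norm_sub_add_norm_sub (Complex.exp (τ * Complex.I)) (r : ℂ) 1
  linarith

/-- The chord `|e^{iτ} - 1| = 2 |sin (τ/2)|` is at least `2|τ|/π` by Jordan's inequality, and
replacing `1` by `r` costs at most a factor 2. -/
lemma abs_le_pi_mul_norm_exp_sub {r : ℝ} (hr0 : 0 ≤ r) (hr1 : r < 1) {τ : ℝ} (hτ : |τ| ≤ Real.pi) :
    |τ| ≤ Real.pi * ‖Complex.exp (τ * Complex.I) - r‖ := by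
  have h1 := norm_exp_sub_one_le_two_mul hr0 hr1 τ
  rw [mul_comm, Complex.norm_exp_I_mul_ofReal_sub_one, Real.norm_eq_abs, abs_mul, abs_two] at h1
  have h2 := Real.mul_abs_le_abs_sin (x := τ / 2) (by rw [abs_div, abs_two]; linarith)
  rw [abs_div, abs_two] at h2
  rw [mul_comm Complex.I] at h1
  have h3 : |τ| / Real.pi ≤ ‖Complex.exp (τ * Complex.I) - r‖ := by
    calc |τ| / Real.pi = 2 / Real.pi * (|τ| / 2) := by ring
      _ ≤ _ := h2
      _ ≤ _ := by linarith
  rwa [div_le_iff₀' Real.pi_pos] at h3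

lemma intervalIntegrable_abs_rpow {p : ℝ} (hp : -1 < p) (a b : ℝ) :
    IntervalIntegrable (fun x : ℝ => |x| ^ p) volume a b := by
  have hpos : ∀ c : ℝ, 0 ≤ c → IntervalIntegrable (fun x : ℝ => |x| ^ p) volume 0 c := by
    intro c hc
    refine (intervalIntegral.intervalIntegrable_rpow' (a := 0) (b := c) hp).congr ?_
    intro x hx
    rw [uIoc_of_le hc] at hx
    simp only
    rw [abs_of_pos hx.1]
  have hall : ∀ c : ℝ, IntervalIntegrable (fun x : ℝ => |x| ^ p) volume 0 c := by
    intro c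
    rcases le_total 0 c with h | h
    · exact hpos c h
    · have := (hpos (-c) (by linarith)).comp_sub_left 0
      simpa using this
  exact (hall a).symm.trans (hall b)

/-- The kernel `1 / |e^{iτ} - r|` is bounded by `(1 - r)^{β - 1}` times an integrable function. -/
lemma inv_norm_exp_sub_le {β r : ℝ} (hβ0 : 0 < β) (hβ1 : β < 1) (hr0 : 0 ≤ r) (hr1 : r < 1) {τ : ℝ}
    (hτ : |τ| ≤ Real.pi) (hτ0 : τ ≠ 0) :
    ‖Complex.exp (τ * Complex.I) - r‖⁻¹ ≤
      (1 - r) ^ (β - 1) * (Real.pi ^ β * |τ| ^ (-β)) := by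
  set x := ‖Complex.exp (τ * Complex.I) - r‖ with hx
  have h1 : 1 - r ≤ x := by
    have := one_sub_norm_le_norm_exp_sub τ r
    rwa [Complex.norm_real, Real.norm_eq_abs, abs_of_nonneg hr0] at this
  have h2 : |τ| ≤ Real.pi * x := abs_le_pi_mul_norm_exp_sub hr0 hr1 hτ
  have hx0 : 0 < x := by linarith
  have hp := Real.pi_pos
  have h3 : x ^ (-β) ≤ Real.pi ^ β * |τ| ^ (-β) := by
    rw [Real.rpow_neg hx0.le, Real.rpow_neg (abs_nonneg _), ← div_eq_mul_inv,
      le_div_iff₀ (Real.rpow_pos_of_pos (abs_pos.mpr hτ0) _), inv_mul_le_iff₀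
      (Real.rpow_pos_of_pos hx0 _), ← Real.mul_rpow hx0.le hp.le, mul_comm x]
    exact Real.rpow_le_rpow (abs_nonneg _) h2 hβ0.le
  have h4 : x ^ (β - 1) ≤ (1 - r) ^ (β - 1) :=
    Real.rpow_le_rpow_of_nonpos (by linarith) h1 (by linarith)
  calc x⁻¹ = x ^ (β - 1) * x ^ (-β) := by
        rw [← Real.rpow_add hx0, ← Real.rpow_neg_one]; congr 1; ring
    _ ≤ _ := mul_le_mul h4 h3 (Real.rpow_nonneg hx0.le _) (Real.rpow_nonneg (by linarith) _)

/-- Kernel times Lipschitz increment: `|τ|` absorbs one power of `|e^{iτ} - r|`, and the remaining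
power is split between `(1 - r)^{β-1}` and the integrable `|τ|^{-β}`. -/
lemma abs_div_norm_exp_sub_sq_le {β r : ℝ} (hβ0 : 0 < β) (hβ1 : β < 1) (hr0 : 0 ≤ r) (hr1 : r < 1)
    {τ : ℝ} (hτ : |τ| ≤ Real.pi) :
    |τ| / ‖Complex.exp (τ * Complex.I) - r‖ ^ 2 ≤
      Real.pi * ((1 - r) ^ (β - 1) * (Real.pi ^ β * |τ| ^ (-β))) := by
  rcases eq_or_ne τ 0 with rfl | h0
  · have := Real.pi_pos
    have : 0 ≤ (1 - r) ^ (β - 1) := Real.rpow_nonneg (by linarith) _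
    rw [abs_zero, zero_div]
    positivity
  have h1 := abs_le_pi_mul_norm_exp_sub hr0 hr1 hτ
  have h2 := inv_norm_exp_sub_le hβ0 hβ1 hr0 hr1 hτ h0
  have hx : 0 < ‖Complex.exp (τ * Complex.I) - r‖ :=
    norm_pos_iff.mpr (exp_sub_ne_zero (by simpa [abs_of_nonneg hr0] using hr1) τ)
  calc |τ| / ‖Complex.exp (τ * Complex.I) - r‖ ^ 2
      ≤ Real.pi * ‖Complex.exp (τ * Complex.I) - r‖ / ‖Complex.exp (τ * Complex.I) - r‖ ^ 2 := by
        gcongr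
    _ = Real.pi * ‖Complex.exp (τ * Complex.I) - r‖⁻¹ := by field_simp
    _ ≤ _ := by gcongr

lemma LipschitzWith.abs_add_sub_le {h : ℝ → ℝ} (hh : LipschitzWith 1 h) (τ θ : ℝ) :
    |h (τ + θ) - h θ| ≤ |τ| := by
  have := hh.dist_le_mul (τ + θ) θ
  simpa [Real.dist_eq] using this

lemma intervalIntegrable_abs_rpow_bound {β : ℝ} (hβ1 : β < 1) (c : ℝ) :
    IntervalIntegrable (fun τ : ℝ => c * (Real.pi ^ β * |τ| ^ (-β))) volume (-Real.pi) Real.pi :=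
  ((intervalIntegrable_abs_rpow (by linarith) _ _).const_mul _).const_mul _

/-- Subtracting `h (arg z)` leaves an increment of size at most `|τ|` against the kernel `2 /
|e^{iτ} - r|²`. A power bound with any `β < 1` suffices, since the Hölder exponent wanted at the end
is below 1. -/
lemma exists_norm_schwarzIntegralDeriv_le {h : ℝ → ℝ} (hper : Function.Periodic h (2 * Real.pi))
    (hh : LipschitzWith 1 h) {β : ℝ} (hβ0 : 0 < β) (hβ1 : β < 1) :
    ∃ K : ℝ, 0 ≤ K ∧ ∀ z : ℂ, ‖z‖ < 1 →
      ‖schwarzIntegralDeriv h z‖ ≤ K * (1 - ‖z‖) ^ (β - 1) := by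
  have hpi := Real.pi_pos
  refine ⟨∫ τ in (-Real.pi)..Real.pi, Real.pi ^ β * |τ| ^ (-β), ?_, fun z hz => ?_⟩
  · refine intervalIntegral.integral_nonneg (by linarith) fun τ _ => ?_
    positivity
  set r := ‖z‖ with hr
  have hz' : ‖(r : ℂ)‖ < 1 := by rwa [Complex.norm_real, norm_norm]
  have e := schwarzIntegralDeriv_polar (h := fun t => h t - h z.arg)
    (fun t => by simp only [hper t]) r z.arg
  rw [Complex.norm_mul_exp_arg_mul_I, ← schwarzIntegralDeriv_eq_sub_const hh.continuous _ hz] at e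
  rw [e, ← neg_mul, ← Complex.ofReal_neg, norm_mul, Complex.norm_exp_ofReal_mul_I, one_mul, norm_mul]
  have hn : ‖(1 / (2 * Real.pi) : ℂ)‖ = 1 / (2 * Real.pi) := by
    rw [norm_div, norm_mul, Complex.norm_real, Real.norm_eq_abs, abs_of_pos hpi]; simp
  have hI : ‖∫ τ in (-Real.pi)..Real.pi, 2 * Complex.exp (τ * Complex.I) /
      (Complex.exp (τ * Complex.I) - r) ^ 2 * ((h (τ + z.arg) - h z.arg : ℝ) : ℂ)‖ ≤
      ∫ τ in (-Real.pi)..Real.pi,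
        2 * Real.pi * (1 - r) ^ (β - 1) * (Real.pi ^ β * |τ| ^ (-β)) := by
    refine intervalIntegral.norm_integral_le_of_norm_le (by linarith)
      (Eventually.of_forall fun τ hτ => ?_) (intervalIntegrable_abs_rpow_bound hβ1 _)
    have h1 := abs_div_norm_exp_sub_sq_le hβ0 hβ1 (norm_nonneg z) hz (τ := τ)
      (abs_le.mpr ⟨hτ.1.le, hτ.2⟩)
    rw [norm_mul, norm_div, norm_mul, norm_pow, Complex.norm_exp_ofReal_mul_I, Complex.norm_real,
      Real.norm_eq_abs]
    simp only [RCLike.norm_ofNat, mul_one]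
    calc 2 / ‖Complex.exp (τ * Complex.I) - r‖ ^ 2 * |h (τ + z.arg) - h z.arg|
        ≤ 2 / ‖Complex.exp (τ * Complex.I) - r‖ ^ 2 * |τ| :=
          mul_le_mul_of_nonneg_left (hh.abs_add_sub_le τ _) (by positivity)
      _ = 2 * (|τ| / ‖Complex.exp (τ * Complex.I) - r‖ ^ 2) := by ring
      _ ≤ 2 * (Real.pi * ((1 - r) ^ (β - 1) * (Real.pi ^ β * |τ| ^ (-β)))) := by gcongr
      _ = _ := by ring
  rw [intervalIntegral.integral_const_mul] at hI
  rw [hn]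
  calc _ ≤ 1 / (2 * Real.pi) * _ := mul_le_mul_of_nonneg_left hI (by positivity)
    _ = _ := by field_simp

lemma re_exp_add_div_exp_sub (τ r : ℝ) :
    ((Complex.exp (τ * Complex.I) + r) / (Complex.exp (τ * Complex.I) - r)).re =
      (1 - r ^ 2) / ‖Complex.exp (τ * Complex.I) - r‖ ^ 2 := by
  have := congrFun (poissonKernel_eq_re_herglotzRieszKernel (c := 0) (w := r))
    (Complex.exp (τ * Complex.I))
  rw [poissonKernel_def, Function.comp_apply, herglotzRieszKernel_def] at this
  simp only [sub_zero, Complex.norm_exp_ofReal_mul_I, Complex.norm_real, Real.norm_eq_abs,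
    sq_abs, one_pow] at this
  exact this.symm

/-- The real part of the kernel is the Poisson kernel, whose numerator `1 - r² ≤ 2(1 - r)` supplies
the extra factor `1 - r`. -/
lemma exists_abs_re_schwarzIntegral_sub_le {h : ℝ → ℝ} (hper : Function.Periodic h (2 * Real.pi))
    (hh : LipschitzWith 1 h) {β : ℝ} (hβ0 : 0 < β) (hβ1 : β < 1) :
    ∃ K : ℝ, ∀ r θ : ℝ, 0 ≤ r → r < 1 →
      |(schwarzIntegral h (r * Complex.exp (θ * Complex.I))).re - h θ| ≤
        K * ((1 - r) * (1 - r) ^ (β - 1)) := by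
  have hpi := Real.pi_pos
  refine ⟨∫ τ in (-Real.pi)..Real.pi, Real.pi ^ β * |τ| ^ (-β), fun r θ hr0 hr1 => ?_⟩
  have hz : ‖(r * Complex.exp (θ * Complex.I) : ℂ)‖ < 1 := by
    rwa [norm_mul, Complex.norm_exp_ofReal_mul_I, Complex.norm_real, Real.norm_eq_abs,
      abs_of_nonneg hr0, mul_one]
  have hr : ‖(r : ℂ)‖ < 1 := by rwa [Complex.norm_real, Real.norm_eq_abs, abs_of_nonneg hr0]
  have e := schwarzIntegral_polar (h := fun t => h t - h θ) (fun t => by simp only [hper t]) r θ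
  rw [← schwarzIntegral_sub_const hh.continuous _ hz] at e
  have e2 : (schwarzIntegral h (r * Complex.exp (θ * Complex.I))).re - h θ =
      1 / (2 * Real.pi) * (∫ τ in (-Real.pi)..Real.pi, (Complex.exp (τ * Complex.I) + r) /
        (Complex.exp (τ * Complex.I) - r) * ((h (τ + θ) - h θ : ℝ) : ℂ)).re := by
    have := congrArg Complex.re e
    rw [Complex.sub_re, Complex.ofReal_re] at this
    rw [this, ← Complex.re_ofReal_mul]
    push_cast
    rfl
  have hc : Continuous fun τ : ℝ => (Complex.exp (τ * Complex.I) + r) /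
        (Complex.exp (τ * Complex.I) - r) * ((h (τ + θ) - h θ : ℝ) : ℂ) :=
    continuous_schwarz_integrand (h := fun τ => h (τ + θ) - h θ)
      ((hh.continuous.comp (by fun_prop)).sub continuous_const) hr
  have e3 := Complex.reCLM.intervalIntegral_comp_comm (hc.intervalIntegrable (μ := volume) (-Real.pi) Real.pi)
  simp only [Complex.reCLM_apply] at e3
  rw [e2, ← e3, abs_mul, abs_of_pos (by positivity : 0 < 1 / (2 * Real.pi))]
  have hI : ‖∫ τ in (-Real.pi)..Real.pi, ((Complex.exp (τ * Complex.I) + r) /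
        (Complex.exp (τ * Complex.I) - r) * ((h (τ + θ) - h θ : ℝ) : ℂ)).re‖ ≤
      ∫ τ in (-Real.pi)..Real.pi,
        2 * Real.pi * ((1 - r) * (1 - r) ^ (β - 1)) * (Real.pi ^ β * |τ| ^ (-β)) := by
    refine intervalIntegral.norm_integral_le_of_norm_le (by linarith)
      (Eventually.of_forall fun τ hτ => ?_) (intervalIntegrable_abs_rpow_bound hβ1 _)
    have h1 := abs_div_norm_exp_sub_sq_le hβ0 hβ1 hr0 hr1 (τ := τ) (abs_le.mpr ⟨hτ.1.le, hτ.2⟩)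
    rw [Complex.re_mul_ofReal, re_exp_add_div_exp_sub, norm_mul, Real.norm_eq_abs,
      Real.norm_eq_abs, abs_of_nonneg (div_nonneg (by nlinarith) (by positivity))]
    calc (1 - r ^ 2) / ‖Complex.exp (τ * Complex.I) - r‖ ^ 2 * |h (τ + θ) - h θ|
        ≤ (2 * (1 - r)) / ‖Complex.exp (τ * Complex.I) - r‖ ^ 2 * |τ| := by
          have : 1 - r ^ 2 ≤ 2 * (1 - r) := by nlinarith
          have h0 : 0 ≤ 2 * (1 - r) := by linarith
          exact mul_le_mul (by gcongr) (hh.abs_add_sub_le τ _) (abs_nonneg _) (by positivity)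
      _ = 2 * (1 - r) * (|τ| / ‖Complex.exp (τ * Complex.I) - r‖ ^ 2) := by ring
      _ ≤ 2 * (1 - r) * _ := mul_le_mul_of_nonneg_left h1 (by linarith)
      _ = _ := by ring
  rw [intervalIntegral.integral_const_mul] at hI
  calc _ ≤ 1 / (2 * Real.pi) * _ := mul_le_mul_of_nonneg_left hI (by positivity)
    _ = _ := by field_simp

lemma tendsto_re_schwarzIntegral {h : ℝ → ℝ} (hper : Function.Periodic h (2 * Real.pi))
    (hh : LipschitzWith 1 h) (θ : ℝ) :
    Tendsto (fun r : ℝ => (schwarzIntegral h (r * Complex.exp (θ * Complex.I))).re) (𝓝[<] 1)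
      (𝓝 (h θ)) := by
  obtain ⟨K, hK⟩ := exists_abs_re_schwarzIntegral_sub_le hper hh (β := 1 / 2) (by norm_num)
    (by norm_num)
  rw [tendsto_iff_norm_sub_tendsto_zero]
  have h1 : Tendsto (fun r : ℝ => K * (1 - r) ^ (1 / 2 : ℝ)) (𝓝[<] 1) (𝓝 0) := by
    have : Continuous fun r : ℝ => K * (1 - r) ^ (1 / 2 : ℝ) :=
      continuous_const.mul ((continuous_const.sub continuous_id).rpow_const
        fun _ => Or.inr (by norm_num))
    refine (tendsto_nhdsWithin_of_tendsto_nhds (this.tendsto 1)).trans_eq ?_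
    norm_num
  refine squeeze_zero' (Eventually.of_forall fun _ => norm_nonneg _) ?_ h1
  have : ∀ᶠ r : ℝ in 𝓝[<] 1, 0 < r := nhdsWithin_le_nhds (lt_mem_nhds one_pos)
  filter_upwards [this, self_mem_nhdsWithin] with r hr0 hr1
  have hr1' : 0 < 1 - r := by have : r < 1 := hr1; linarith
  refine (hK r θ hr0.le hr1).trans_eq ?_
  nth_rewrite 1 [← Real.rpow_one (1 - r)]
  rw [← Real.rpow_add hr1']
  norm_num

/-! ### The conjugate function stays below π/2 -/

lemma im_exp_add_div_exp_sub (τ r : ℝ) :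
    ((Complex.exp (τ * Complex.I) + r) / (Complex.exp (τ * Complex.I) - r)).im =
      -(2 * r * Real.sin τ) / (1 - 2 * r * Real.cos τ + r ^ 2) := by
  rw [Complex.div_im, Complex.normSq_apply]
  simp only [Complex.add_re, Complex.add_im, Complex.sub_re, Complex.sub_im,
    Complex.exp_ofReal_mul_I_re, Complex.exp_ofReal_mul_I_im, Complex.ofReal_re, Complex.ofReal_im]
  have : (Real.cos τ - r) * (Real.cos τ - r) + (Real.sin τ - 0) * (Real.sin τ - 0) =
      1 - 2 * r * Real.cos τ + r ^ 2 := by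
    linear_combination Real.sin_sq_add_cos_sq τ
  rw [this, ← sub_div]
  congr 1
  ring

/-- In half angles this is `x cos x ≤ sin x`, that is `x ≤ tan x`, at `x = τ/2`. -/
lemma mul_sin_le_two_mul_one_sub_cos {τ : ℝ} (h0 : 0 ≤ τ) (h1 : τ ≤ Real.pi / 2) :
    τ * Real.sin τ ≤ 2 * (1 - Real.cos τ) := by
  have hc : 0 < Real.cos (τ / 2) :=
    Real.cos_pos_of_mem_Ioo ⟨by linarith [Real.pi_pos], by linarith [Real.pi_pos]⟩
  have ht : τ / 2 * Real.cos (τ / 2) ≤ Real.sin (τ / 2) := by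
    rw [← le_div_iff₀ hc, ← Real.tan_eq_sin_div_cos]
    exact Real.le_tan (by linarith) (by linarith [Real.pi_pos])
  have hs : 0 ≤ Real.sin (τ / 2) := Real.sin_nonneg_of_nonneg_of_le_pi (by linarith)
    (by linarith [Real.pi_pos])
  have e1 : Real.sin τ = 2 * Real.sin (τ / 2) * Real.cos (τ / 2) := by
    rw [← Real.sin_two_mul]; congr 1; ring
  have e2 : Real.cos τ = 1 - 2 * Real.sin (τ / 2) ^ 2 := by
    have := Real.cos_two_mul (τ / 2)
    rw [mul_div_cancel₀ τ two_ne_zero] at this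
    linarith [Real.sin_sq_add_cos_sq (τ / 2)]
  rw [e1, e2]
  nlinarith

/-- The Schwarz integral of a `1`-Lipschitz density has imaginary part less than `π / 2`. -/
lemma abs_im_schwarzIntegral_le {h : ℝ → ℝ} (hper : Function.Periodic h (2 * Real.pi))
    (hh : LipschitzWith 1 h) {z : ℂ} (hz : ‖z‖ < 1) :
    |(schwarzIntegral h z).im| ≤ 1 + Real.pi / 8 := by
  have hpi := Real.pi_pos
  set r := ‖z‖ with hr
  set θ := z.arg
  have hr0 : 0 ≤ r := norm_nonneg z
  have hz' : ‖(r : ℂ)‖ < 1 := by rwa [Complex.norm_real, norm_norm]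
  have e := schwarzIntegral_polar hper r θ
  rw [Complex.norm_mul_exp_arg_mul_I] at e
  set q : ℝ → ℝ := fun τ => -(2 * r * Real.sin τ) / (1 - 2 * r * Real.cos τ + r ^ 2) with hq
  have hD : ∀ τ, 0 < 1 - 2 * r * Real.cos τ + r ^ 2 := fun τ => by
    nlinarith [Real.cos_le_one τ, mul_pos (sub_pos.mpr hz) (sub_pos.mpr hz)]
  have hqc : Continuous q := by
    refine Continuous.div (by fun_prop) (by fun_prop) fun τ => (hD τ).ne'
  have hhc := hh.continuous
  have hc : Continuous fun τ : ℝ => (Complex.exp (τ * Complex.I) + r) /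
        (Complex.exp (τ * Complex.I) - r) * (h (τ + θ) : ℂ) :=
    continuous_schwarz_integrand (h := fun τ => h (τ + θ)) (by fun_prop) hz'
  have e2 : (schwarzIntegral h z).im =
      1 / (2 * Real.pi) * ∫ τ in (-Real.pi)..Real.pi, q τ * h (τ + θ) := by
    have e3 := Complex.imCLM.intervalIntegral_comp_comm (hc.intervalIntegrable (μ := volume) (-Real.pi) Real.pi)
    simp only [Complex.imCLM_apply, Complex.im_mul_ofReal, im_exp_add_div_exp_sub] at e3
    rw [e, hq, e3, ← Complex.im_ofReal_mul]
    push_cast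
    rfl
  have hc1 : Continuous fun τ => q τ * h (τ + θ) := by fun_prop
  have hc1n : Continuous fun τ => q (-τ) * h (-τ + θ) := by fun_prop
  -- The conjugate kernel `q` is odd, so folding the integral at `0` replaces `h` by the increment
  -- `h(θ + τ) - h(θ - τ)`.
  have e4 : ∫ τ in (-Real.pi)..Real.pi, q τ * h (τ + θ) =
      ∫ τ in (0 : ℝ)..Real.pi, q τ * (h (τ + θ) - h (-τ + θ)) := by
    rw [← intervalIntegral.integral_add_adjacent_intervals (hc1.intervalIntegrable _ 0)
      (hc1.intervalIntegrable 0 _)]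
    have := intervalIntegral.integral_comp_neg (a := 0) (b := Real.pi) fun τ => q τ * h (τ + θ)
    rw [neg_zero] at this
    rw [← this, ← intervalIntegral.integral_add
      (hc1n.intervalIntegrable _ _) (hc1.intervalIntegrable _ _)]
    congr 1
    ext τ
    have : q (-τ) = -q τ := by simp only [hq, Real.sin_neg, Real.cos_neg]; ring
    rw [this]
    ring
  have hc2 : Continuous fun τ => q τ * (h (τ + θ) - h (-τ + θ)) := by fun_prop
  have hlip : ∀ s t, |h s - h t| ≤ |s - t| := fun s t => by
    simpa [Real.dist_eq] using hh.dist_le_mul s t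
  have hqs : ∀ τ ∈ Icc 0 Real.pi, |q τ| * (1 - 2 * r * Real.cos τ + r ^ 2) =
      2 * r * Real.sin τ := by
    intro τ hτ
    have : 0 ≤ 2 * r * Real.sin τ := by
      have := Real.sin_nonneg_of_nonneg_of_le_pi hτ.1 hτ.2
      positivity
    rw [hq, abs_div, abs_neg, abs_of_nonneg this, abs_of_pos (hD τ), div_mul_cancel₀ _ (hD τ).ne']
  -- On `[0, π/2]` the increment is at most `2τ`, and `|q τ| 2τ ≤ 4` uniformly in `r`. This half
  -- contributes `2π`, hence `1` after division by `2π`.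
  have b1 : ‖∫ τ in (0 : ℝ)..(Real.pi / 2), q τ * (h (τ + θ) - h (-τ + θ))‖ ≤
      ∫ τ in (0 : ℝ)..(Real.pi / 2), (4 : ℝ) := by
    refine intervalIntegral.norm_integral_le_of_norm_le (by linarith)
      (Eventually.of_forall fun τ hτ => ?_) intervalIntegrable_const
    have h1 := hlip (τ + θ) (-τ + θ)
    have h2 : |τ + θ - (-τ + θ)| = 2 * τ := by
      rw [abs_of_nonneg (by linarith [hτ.1])]; ring
    have h3 := hqs τ ⟨hτ.1.le, by linarith [hτ.2]⟩
    have h4 := mul_sin_le_two_mul_one_sub_cos hτ.1.le hτ.2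
    have h5 : |q τ| * (2 * τ) ≤ 4 := by
      refine le_of_mul_le_mul_right ?_ (hD τ)
      calc |q τ| * (2 * τ) * (1 - 2 * r * Real.cos τ + r ^ 2)
          = 4 * r * (τ * Real.sin τ) := by linear_combination (2 * τ) * h3
        _ ≤ 4 * r * (2 * (1 - Real.cos τ)) := by gcongr
        _ ≤ _ := by nlinarith [sq_nonneg (1 - r)]
    rw [norm_mul, Real.norm_eq_abs, Real.norm_eq_abs]
    exact (mul_le_mul_of_nonneg_left (h1.trans_eq h2) (abs_nonneg _)).trans h5
  -- On `[π/2, π]` the two points are compared the other way round the circle, at distance `2(π -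
  -- τ)`, and `|q| ≤ 1` because the cosine is nonpositive. This half contributes `π²/4`, hence `π/8`
  -- after division by `2π`.
  have b2 : ‖∫ τ in (Real.pi / 2)..Real.pi, q τ * (h (τ + θ) - h (-τ + θ))‖ ≤
      ∫ τ in (Real.pi / 2)..Real.pi, 2 * (Real.pi - τ) := by
    refine intervalIntegral.norm_integral_le_of_norm_le (by linarith)
      (Eventually.of_forall fun τ hτ => ?_) (by apply Continuous.intervalIntegrable; fun_prop)
    have h1 := hlip (τ + θ) (-τ + θ + 2 * Real.pi)
    rw [hper (-τ + θ)] at h1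
    have h2 : |τ + θ - (-τ + θ + 2 * Real.pi)| = 2 * (Real.pi - τ) := by
      rw [abs_of_nonpos (by linarith [hτ.2])]; ring
    have h3 := hqs τ ⟨by linarith [hτ.1], hτ.2⟩
    have hcos : Real.cos τ ≤ 0 :=
      Real.cos_nonpos_of_pi_div_two_le_of_le hτ.1.le (by linarith [hτ.2])
    have h5 : |q τ| ≤ 1 := by
      refine le_of_mul_le_mul_right ?_ (hD τ)
      rw [h3]
      nlinarith [Real.sin_le_one τ, sq_nonneg (1 - r), mul_nonneg hr0 (neg_nonneg.mpr hcos)]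
    rw [norm_mul, Real.norm_eq_abs, Real.norm_eq_abs]
    calc |q τ| * |h (τ + θ) - h (-τ + θ)| ≤ 1 * (2 * (Real.pi - τ)) :=
          mul_le_mul h5 (h1.trans_eq h2) (abs_nonneg _) zero_le_one
      _ = _ := one_mul _
  have i2 : ∫ τ in (Real.pi / 2)..Real.pi, 2 * (Real.pi - τ) = Real.pi ^ 2 / 4 := by
    rw [intervalIntegral.integral_const_mul, intervalIntegral.integral_sub intervalIntegrable_const
      intervalIntegral.intervalIntegrable_id]
    simp only [intervalIntegral.integral_const, smul_eq_mul, integral_id]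
    ring
  rw [intervalIntegral.integral_const, smul_eq_mul] at b1
  rw [i2] at b2
  rw [e2, e4, ← intervalIntegral.integral_add_adjacent_intervals
    (hc2.intervalIntegrable 0 (Real.pi / 2)) (hc2.intervalIntegrable _ _), abs_mul,
    abs_of_pos (by positivity : 0 < 1 / (2 * Real.pi))]
  calc _ ≤ 1 / (2 * Real.pi) * ((Real.pi / 2 - 0) * 4 + Real.pi ^ 2 / 4) :=
        mul_le_mul_of_nonneg_left ((abs_add_le _ _).trans (add_le_add b1 b2)) (by positivity)
    _ = _ := by field_simp; ring

/-! ### Hölder continuity up to the circle -/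

/-- Strict convexity of the disk: the parallelogram-type identity for `|·|²` along a chord, combined
with `1 - x² ≤ 2(1 - x)`. -/
lemma mul_norm_sub_sq_le_one_sub_norm {z w : ℂ} (hz : ‖z‖ ≤ 1) (hw : ‖w‖ ≤ 1) {t : ℝ}
    (ht0 : 0 ≤ t) (ht1 : t ≤ 1) :
    t * (1 - t) * ‖w - z‖ ^ 2 / 2 ≤ 1 - ‖z + t * (w - z)‖ := by
  have e : ‖z + t * (w - z)‖ ^ 2 =
      (1 - t) * ‖z‖ ^ 2 + t * ‖w‖ ^ 2 - t * (1 - t) * ‖w - z‖ ^ 2 := by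
    simp only [Complex.sq_norm, Complex.normSq_apply, Complex.add_re, Complex.add_im,
      Complex.mul_re, Complex.mul_im, Complex.sub_re, Complex.sub_im, Complex.ofReal_re,
      Complex.ofReal_im]
    ring
  have hz2 : ‖z‖ ^ 2 ≤ 1 := pow_le_one₀ (norm_nonneg _) hz
  have hw2 : ‖w‖ ^ 2 ≤ 1 := pow_le_one₀ (norm_nonneg _) hw
  nlinarith [sq_nonneg (1 - ‖z + t * (w - z)‖)]

lemma norm_add_mul_sub_lt_one {z w : ℂ} (hz : ‖z‖ < 1) (hw : ‖w‖ < 1) {t : ℝ}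
    (ht0 : 0 ≤ t) (ht1 : t ≤ 1) : ‖z + t * (w - z)‖ < 1 := by
  have := (convex_ball (0 : ℂ) 1).add_smul_sub_mem (mem_ball_zero_iff.mpr hz)
    (mem_ball_zero_iff.mpr hw) ⟨ht0, ht1⟩
  simpa using this

/-- Since `1/(t(1-t)) = 1/t + 1/(1-t)`, this is subadditivity of `x ↦ x^{-p}` with `-p ∈ [0, 1]`. -/
lemma mul_one_sub_rpow_le {p t : ℝ} (hp0 : -1 ≤ p) (hp1 : p ≤ 0) (ht0 : 0 < t) (ht1 : t < 1) :
    (t * (1 - t)) ^ p ≤ t ^ p + (1 - t) ^ p := by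
  have h1 : 0 < 1 - t := by linarith
  have e : (t * (1 - t))⁻¹ = t⁻¹ + (1 - t)⁻¹ := by field_simp; ring
  rw [← neg_neg p, Real.rpow_neg (by positivity), Real.rpow_neg ht0.le, Real.rpow_neg h1.le,
    ← Real.inv_rpow (by positivity), ← Real.inv_rpow ht0.le, ← Real.inv_rpow h1.le, e]
  exact Real.rpow_add_le_add_rpow (by positivity) (by positivity) (by linarith) (by linarith)

/-- A holomorphic function on the disk with `|S'(z)| ≤ K (1 - |z|)^{β - 1}`, `1/2 < β < 1`, is
Hölder continuous with exponent `2β - 1`. -/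
lemma exists_holder_of_deriv_le {S S' : ℂ → ℂ} (hS : ∀ z, ‖z‖ < 1 → HasDerivAt S (S' z) z)
    {β K : ℝ} (hβ0 : 0 < β) (hβ1 : β < 1) (hK : 0 ≤ K)
    (hS' : ∀ z, ‖z‖ < 1 → ‖S' z‖ ≤ K * (1 - ‖z‖) ^ (β - 1)) :
    ∃ C : ℝ, 0 ≤ C ∧ ∀ z w, ‖z‖ < 1 → ‖w‖ < 1 → ‖S w - S z‖ ≤ C * ‖w - z‖ ^ (2 * β - 1) := by
  set k : ℝ → ℝ := fun t => t ^ (β - 1) + (1 - t) ^ (β - 1) with hk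
  have hki : IntervalIntegrable k volume 0 1 := by
    have h1 := intervalIntegral.intervalIntegrable_rpow' (a := 0) (b := 1) (r := β - 1)
      (by linarith)
    have h2 := (intervalIntegral.intervalIntegrable_rpow' (a := 1) (b := 0) (r := β - 1)
      (by linarith)).comp_sub_left 1
    simp only [sub_self, sub_zero] at h2
    exact h1.add h2
  refine ⟨K * (1 / 2) ^ (β - 1) * ∫ t in (0 : ℝ)..1, k t, ?_, fun z w hz hw => ?_⟩
  · refine mul_nonneg (by positivity) (intervalIntegral.integral_nonneg zero_le_one fun t ht => ?_)
    exact add_nonneg (Real.rpow_nonneg ht.1 _) (Real.rpow_nonneg (by linarith [ht.2]) _)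
  rcases eq_or_ne w z with rfl | hne
  · rw [sub_self, norm_zero]
    have : 0 ≤ ∫ t in (0 : ℝ)..1, k t := intervalIntegral.integral_nonneg zero_le_one fun t ht =>
      add_nonneg (Real.rpow_nonneg ht.1 _) (Real.rpow_nonneg (by linarith [ht.2]) _)
    rw [sub_self, norm_zero]
    have h0 : (0 : ℝ) ≤ 0 ^ (2 * β - 1) := Real.rpow_nonneg le_rfl _
    positivity
  have hd : 0 < ‖w - z‖ := norm_pos_iff.mpr (sub_ne_zero.mpr hne)
  have hderiv : ∀ t ∈ uIcc (0 : ℝ) 1, HasDerivAt (fun t : ℝ => S (z + t * (w - z)))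
      (S' (z + t * (w - z)) * (w - z)) t := by
    intro t ht
    rw [uIcc_of_le zero_le_one] at ht
    have h1 := hS _ (norm_add_mul_sub_lt_one hz hw ht.1 ht.2)
    have h2 : HasDerivAt (fun t : ℝ => z + t * (w - z)) (1 * (w - z)) t :=
      ((Complex.ofRealCLM.hasDerivAt (x := t)).mul_const (w - z)).const_add z
    rw [one_mul] at h2
    exact h1.comp_of_eq t h2 rfl
  have hcont : ContinuousOn S' (Metric.ball 0 1) := by
    have hdiff : DifferentiableOn ℂ S (Metric.ball 0 1) := fun z hz =>
      (hS z (mem_ball_zero_iff.mp hz)).differentiableAt.differentiableWithinAt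
    refine (hdiff.deriv Metric.isOpen_ball).continuousOn.congr fun z hz => ?_
    exact (hS z (mem_ball_zero_iff.mp hz)).deriv.symm
  have hint : IntervalIntegrable (fun t : ℝ => S' (z + t * (w - z)) * (w - z)) volume 0 1 := by
    refine ContinuousOn.intervalIntegrable (ContinuousOn.mul ?_ continuousOn_const)
    refine hcont.comp (by fun_prop) fun t ht => ?_
    rw [uIcc_of_le zero_le_one] at ht
    exact mem_ball_zero_iff.mpr (norm_add_mul_sub_lt_one hz hw ht.1 ht.2)
  have hFTC := intervalIntegral.integral_eq_sub_of_hasDerivAt hderiv hint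
  simp only [Complex.ofReal_one, one_mul, Complex.ofReal_zero, zero_mul, add_zero,
    add_sub_cancel] at hFTC
  rw [← hFTC]
  -- Integration along the chord, whose depth inside the disk is at least `t(1-t)|w-z|²/2`. Raised
  -- to the power `β - 1` and multiplied by `|w - z|`, this produces the exponent `2(β-1) + 1 = 2β -
  -- 1`.
  have hb : ‖∫ t in (0 : ℝ)..1, S' (z + t * (w - z)) * (w - z)‖ ≤
      ∫ t in (0 : ℝ)..1, K * (1 / 2) ^ (β - 1) * ‖w - z‖ ^ (2 * β - 1) * k t := by
    refine intervalIntegral.norm_integral_le_of_norm_le zero_le_one ?_ (hki.const_mul _)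
    -- The endpoint is discarded because `0 ^ (β - 1)` takes the default value `0` there, so `k 1`
    -- is not the infinite weight it stands for.
    have hne1 : ∀ᵐ t : ℝ, t ≠ 1 := by simp [ae_iff]
    filter_upwards [hne1] with t ht1 ht
    have ht1 : t < 1 := lt_of_le_of_ne ht.2 ht1
    have ht0 := ht.1
    have h1 := hS' _ (norm_add_mul_sub_lt_one hz hw ht.1.le ht.2)
    have h2 := mul_norm_sub_sq_le_one_sub_norm hz.le hw.le ht.1.le ht.2
    have ht2 : 0 < 1 - t := by linarith
    have h3 := Real.rpow_le_rpow_of_nonpos (z := β - 1) (by positivity) h2 (by linarith)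
    have h4 := mul_one_sub_rpow_le (p := β - 1) (by linarith) (by linarith) ht0 ht1
    have h5 : (t * (1 - t) * ‖w - z‖ ^ 2 / 2) ^ (β - 1) =
        (1 / 2) ^ (β - 1) * ‖w - z‖ ^ (2 * β - 2) * (t * (1 - t)) ^ (β - 1) := by
      have e1 : t * (1 - t) * ‖w - z‖ ^ 2 / 2 = 1 / 2 * ‖w - z‖ ^ 2 * (t * (1 - t)) := by ring
      rw [e1, Real.mul_rpow (by positivity) (by positivity), Real.mul_rpow (by positivity)
        (by positivity), ← Real.rpow_natCast, ← Real.rpow_mul hd.le]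
      congr 3
      push_cast; ring
    have h6 : ‖w - z‖ ^ (2 * β - 1) = ‖w - z‖ ^ (2 * β - 2) * ‖w - z‖ := by
      rw [← Real.rpow_add_one hd.ne']; congr 1; ring
    rw [norm_mul, h6]
    calc ‖S' (z + t * (w - z))‖ * ‖w - z‖
        ≤ K * ((1 / 2) ^ (β - 1) * ‖w - z‖ ^ (2 * β - 2) * (t * (1 - t)) ^ (β - 1)) * ‖w - z‖ := by
          rw [← h5]; gcongr; exact h1.trans (by gcongr)
      _ ≤ K * ((1 / 2) ^ (β - 1) * ‖w - z‖ ^ (2 * β - 2) * k t) * ‖w - z‖ := by gcongr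
      _ = _ := by ring
  rw [intervalIntegral.integral_const_mul] at hb
  exact hb.trans_eq (by ring)

/-- The radial retraction of the plane onto the closed unit disk. -/
noncomputable def diskRetraction (z : ℂ) : ℂ := ((max 1 ‖z‖ : ℝ) : ℂ)⁻¹ * z

lemma continuous_diskRetraction : Continuous diskRetraction := by
  refine Continuous.mul (Continuous.inv₀ (by fun_prop) fun z => ?_) continuous_id
  exact_mod_cast (lt_of_lt_of_le one_pos (le_max_left 1 ‖z‖)).ne'

lemma diskRetraction_of_mem {z : ℂ} (hz : z ∈ Metric.closedBall (0 : ℂ) 1) :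
    diskRetraction z = z := by
  rw [diskRetraction, max_eq_left (mem_closedBall_zero_iff.mp hz), Complex.ofReal_one, inv_one,
    one_mul]

lemma diskRetraction_mem (z : ℂ) : diskRetraction z ∈ Metric.closedBall (0 : ℂ) 1 := by
  have h : 0 < max 1 ‖z‖ := lt_of_lt_of_le one_pos (le_max_left 1 ‖z‖)
  rw [mem_closedBall_zero_iff, diskRetraction, norm_mul, norm_inv, Complex.norm_real,
    Real.norm_eq_abs, abs_of_pos h, inv_mul_le_iff₀ h, mul_one]
  exact le_max_right _ _

lemma closure_unitBall : closure (Metric.ball (0 : ℂ) 1) = Metric.closedBall 0 1 :=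
  closure_ball 0 one_ne_zero

/-- A function which is Hölder continuous on the open unit disk agrees there with a continuous
function on the plane which is Hölder continuous on the closed disk. -/
lemma exists_continuous_extension_of_holder {S : ℂ → ℂ} {C p : ℝ} (hp : 0 < p)
    (hS : ∀ z w, ‖z‖ < 1 → ‖w‖ < 1 → ‖S w - S z‖ ≤ C * ‖w - z‖ ^ p) :
    ∃ G : ℂ → ℂ, Continuous G ∧ EqOn G S (Metric.ball 0 1) ∧
      ∀ z ∈ Metric.closedBall (0 : ℂ) 1, ∀ w ∈ Metric.closedBall (0 : ℂ) 1,
        ‖G w - G z‖ ≤ C * ‖w - z‖ ^ p := by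
  have hcp : Continuous fun x : ℝ => C * x ^ p :=
    continuous_const.mul (Real.continuous_rpow_const hp.le)
  have huc : UniformContinuousOn S (Metric.ball 0 1) := by
    rw [Metric.uniformContinuousOn_iff]
    intro ε hε
    have h0 : C * (0 : ℝ) ^ p < ε := by rwa [Real.zero_rpow hp.ne', mul_zero]
    obtain ⟨δ, hδ, hδ'⟩ := Metric.eventually_nhds_iff.mp (hcp.continuousAt.eventually_lt
      continuousAt_const h0)
    refine ⟨δ, hδ, fun x hx y hy hxy => ?_⟩
    rw [dist_eq_norm]
    refine (hS _ _ (mem_ball_zero_iff.mp hy) (mem_ball_zero_iff.mp hx)).trans_lt (hδ' ?_)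
    rw [Real.dist_eq, sub_zero, abs_norm]
    rwa [← dist_eq_norm]
  have hlim : ∀ x ∈ Metric.closedBall (0 : ℂ) 1,
      ∃ y, Tendsto S (𝓝[Metric.ball 0 1] x) (𝓝 y) := by
    intro x hx
    rw [← closure_unitBall] at hx
    have := mem_closure_iff_nhdsWithin_neBot.mp hx
    have hc : Cauchy (𝓝[Metric.ball 0 1] x) := cauchy_nhds.mono inf_le_left
    exact CompleteSpace.complete (hc.map_of_le huc inf_le_right)
  have hcont := continuousOn_extendFrom closure_unitBall.ge hlim
  obtain ⟨G, hG, hEq⟩ : ∃ G : ℂ → ℂ, Continuous G ∧ EqOn G S (Metric.ball 0 1) := by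
    -- Composing with the retraction makes the extension continuous on the whole plane, so later
    -- continuity and integrability arguments need no domain restrictions.
    refine ⟨fun z => extendFrom (Metric.ball (0 : ℂ) 1) S (diskRetraction z),
      hcont.comp_continuous continuous_diskRetraction diskRetraction_mem, fun z hz => ?_⟩
    simp only
    rw [diskRetraction_of_mem (Metric.ball_subset_closedBall hz)]
    exact extendFrom_extends huc.continuousOn z hz
  refine ⟨G, hG, hEq, fun z hz w hw => ?_⟩
  have hzw : (z, w) ∈ closure (Metric.ball (0 : ℂ) 1 ×ˢ Metric.ball (0 : ℂ) 1) := by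
    rw [closure_prod_eq, closure_unitBall]; exact ⟨hz, hw⟩
  refine le_on_closure (f := fun x : ℂ × ℂ => ‖G x.2 - G x.1‖)
    (g := fun x : ℂ × ℂ => C * ‖x.2 - x.1‖ ^ p) ?_ ?_ ?_ hzw
  · rintro ⟨x, y⟩ ⟨hx, hy⟩
    simp only
    rw [hEq hx, hEq hy]
    exact hS x y (mem_ball_zero_iff.mp hx) (mem_ball_zero_iff.mp hy)
  · exact ((hG.comp continuous_snd).sub (hG.comp continuous_fst)).norm.continuousOn
  · exact (hcp.comp (continuous_snd.sub continuous_fst).norm).continuousOn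

/-- Boundary behaviour of the Schwarz integral of a `1`-Lipschitz density. -/
theorem exists_extension_schwarzIntegral {h : ℝ → ℝ} (hper : Function.Periodic h (2 * Real.pi))
    (hh : LipschitzWith 1 h) {α : ℝ} (hα0 : 0 < α) (hα1 : α < 1) :
    ∃ (G : ℂ → ℂ) (C : ℝ), 0 ≤ C ∧ Continuous G ∧
      EqOn G (schwarzIntegral h) (Metric.ball 0 1) ∧
      (∀ z ∈ Metric.closedBall (0 : ℂ) 1, ∀ w ∈ Metric.closedBall (0 : ℂ) 1,
        ‖G w - G z‖ ≤ C * ‖w - z‖ ^ α) ∧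
      (∀ z ∈ Metric.closedBall (0 : ℂ) 1, |(G z).im| ≤ 1 + Real.pi / 8) ∧
      ∀ θ : ℝ, (G (Complex.exp (θ * Complex.I))).re = h θ := by
  -- The choice of `β` makes `2β - 1 = α`.
  obtain ⟨K, hK0, hK⟩ := exists_norm_schwarzIntegralDeriv_le hper hh (β := (1 + α) / 2)
    (by linarith) (by linarith)
  obtain ⟨C, hC0, hC⟩ := exists_holder_of_deriv_le
    (fun z hz => hasDerivAt_schwarzIntegral hh.continuous hz) (by linarith) (by linarith) hK0 hK
  rw [show 2 * ((1 + α) / 2) - 1 = α by ring] at hC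
  obtain ⟨G, hG, hGS, hGC⟩ := exists_continuous_extension_of_holder hα0 hC
  refine ⟨G, C, hC0, hG, hGS, hGC, fun z hz => ?_, fun θ => ?_⟩
  · rw [← closure_unitBall] at hz
    refine le_on_closure (f := fun z => |(G z).im|) (g := fun _ => 1 + Real.pi / 8) ?_
      (by fun_prop) continuousOn_const hz
    intro w hw
    rw [hGS hw]
    exact abs_im_schwarzIntegral_le hper hh (mem_ball_zero_iff.mp hw)
  · have h1 : Tendsto (fun r : ℝ => (G (r * Complex.exp (θ * Complex.I))).re) (𝓝[<] 1)
        (𝓝 (G (Complex.exp (θ * Complex.I))).re) := by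
      have : Continuous fun r : ℝ => (G (r * Complex.exp (θ * Complex.I))).re := by fun_prop
      refine tendsto_nhdsWithin_of_tendsto_nhds ((this.tendsto 1).trans_eq ?_)
      rw [Complex.ofReal_one, one_mul]
    refine tendsto_nhds_unique h1 ((tendsto_re_schwarzIntegral hper hh θ).congr' ?_)
    have : ∀ᶠ r : ℝ in 𝓝[<] 1, 0 < r := nhdsWithin_le_nhds (lt_mem_nhds one_pos)
    filter_upwards [this, self_mem_nhdsWithin] with r hr0 hr1
    rw [hGS]
    rw [mem_ball_zero_iff, norm_mul, Complex.norm_exp_ofReal_mul_I, Complex.norm_real,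
      Real.norm_eq_abs, abs_of_pos hr0, mul_one]
    exact hr1

/-! ### Disk charts and the Noshiro–Warschawski criterion -/

/-- `f` is a conformal map of the open unit disk which extends to the closed disk with derivative
`z ↦ A z z`, Hölder continuous with exponent `α`; `A z w` is the slope of `f` between `z` and
`w`, and it is bounded away from zero. -/
structure IsDiskChart (α : ℝ) (f : ℂ → ℂ) (A : ℂ → ℂ → ℂ) : Prop where
  continuous : Continuous fun p : ℂ × ℂ => A p.1 p.2
  sub_eq : ∀ z ∈ Metric.closedBall (0 : ℂ) 1, ∀ w ∈ Metric.closedBall (0 : ℂ) 1,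
    f w - f z = (w - z) * A z w
  exists_le_norm : ∃ c > 0, ∀ z ∈ Metric.closedBall (0 : ℂ) 1, ∀ w ∈ Metric.closedBall (0 : ℂ) 1,
    c ≤ ‖A z w‖
  holder : ∃ C, 0 ≤ C ∧ ∀ z ∈ Metric.closedBall (0 : ℂ) 1, ∀ w ∈ Metric.closedBall (0 : ℂ) 1,
    ‖A w w - A z z‖ ≤ C * ‖w - z‖ ^ α

/-- The mean of `F` over the segment from `z` to `w`. -/
noncomputable def segmentMean (F : ℂ → ℂ) (z w : ℂ) : ℂ := ∫ t in (0 : ℝ)..1, F (z + t * (w - z))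

lemma continuous_segmentMean {F : ℂ → ℂ} (hF : Continuous F) :
    Continuous fun p : ℂ × ℂ => segmentMean F p.1 p.2 := by
  refine intervalIntegral.continuous_parametric_intervalIntegral_of_continuous'
    (f := fun (p : ℂ × ℂ) (t : ℝ) => F (p.1 + t * (p.2 - p.1))) ?_ 0 1
  fun_prop

lemma segmentMean_self (F : ℂ → ℂ) (z : ℂ) : segmentMean F z z = F z := by
  simp [segmentMean]

lemma add_mul_sub_mem_closedBall {z w : ℂ} (hz : z ∈ Metric.closedBall (0 : ℂ) 1)
    (hw : w ∈ Metric.closedBall (0 : ℂ) 1) {t : ℝ} (ht : t ∈ Icc (0 : ℝ) 1) :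
    z + t * (w - z) ∈ Metric.closedBall (0 : ℂ) 1 := by
  simpa using (convex_closedBall (0 : ℂ) 1).add_smul_sub_mem hz hw ht

/-- Averaging over a segment, which stays in the convex disk, preserves a lower bound on the real
part. This keeps the slopes of the primitive away from zero. -/
lemma le_re_segmentMean {F : ℂ → ℂ} (hF : Continuous F) {c : ℝ}
    (hc : ∀ z ∈ Metric.closedBall (0 : ℂ) 1, c ≤ (F z).re) {z w : ℂ}
    (hz : z ∈ Metric.closedBall (0 : ℂ) 1) (hw : w ∈ Metric.closedBall (0 : ℂ) 1) :
    c ≤ (segmentMean F z w).re := by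
  have hcont : Continuous fun t : ℝ => F (z + t * (w - z)) := by fun_prop
  have e := Complex.reCLM.intervalIntegral_comp_comm
    (hcont.intervalIntegrable (μ := volume) 0 1)
  simp only [Complex.reCLM_apply] at e
  rw [segmentMean, ← e]
  calc c = ∫ _ in (0 : ℝ)..1, c := by simp
    _ ≤ _ := intervalIntegral.integral_mono_on zero_le_one intervalIntegrable_const
      ((Complex.continuous_re.comp hcont).intervalIntegrable _ _)
      fun t ht => hc _ (add_mul_sub_mem_closedBall hz hw ht)

lemma sub_eq_mul_segmentMean {F g : ℂ → ℂ} (hF : Continuous F)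
    (hg : ∀ z ∈ Metric.ball (0 : ℂ) 1, HasDerivAt g (F z) z) {z w : ℂ}
    (hz : z ∈ Metric.ball (0 : ℂ) 1) (hw : w ∈ Metric.ball (0 : ℂ) 1) :
    g w - g z = (w - z) * segmentMean F z w := by
  have hderiv : ∀ t ∈ uIcc (0 : ℝ) 1, HasDerivAt (fun t : ℝ => g (z + t * (w - z)))
      (F (z + t * (w - z)) * (w - z)) t := by
    intro t ht
    rw [uIcc_of_le zero_le_one] at ht
    have h2 : HasDerivAt (fun t : ℝ => z + t * (w - z)) (1 * (w - z)) t :=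
      ((Complex.ofRealCLM.hasDerivAt (x := t)).mul_const (w - z)).const_add z
    rw [one_mul] at h2
    refine (hg _ ?_).comp_of_eq t h2 rfl
    exact mem_ball_zero_iff.mpr (norm_add_mul_sub_lt_one (mem_ball_zero_iff.mp hz)
      (mem_ball_zero_iff.mp hw) ht.1 ht.2)
  have hcont : Continuous fun t : ℝ => F (z + t * (w - z)) * (w - z) := by fun_prop
  have := intervalIntegral.integral_eq_sub_of_hasDerivAt hderiv (hcont.intervalIntegrable _ _)
  simp only [Complex.ofReal_one, one_mul, Complex.ofReal_zero, zero_mul, add_zero,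
    add_sub_cancel, intervalIntegral.integral_mul_const] at this
  rw [← this, mul_comm]
  rfl

/-- The Noshiro–Warschawski criterion up to the boundary. -/
theorem isDiskChart_of_le_re {F : ℂ → ℂ} (hF : Continuous F)
    (hFd : DifferentiableOn ℂ F (Metric.ball 0 1)) {c : ℝ} (hc0 : 0 < c)
    (hc : ∀ z ∈ Metric.closedBall (0 : ℂ) 1, c ≤ (F z).re) {C α : ℝ} (hC0 : 0 ≤ C)
    (hC : ∀ z ∈ Metric.closedBall (0 : ℂ) 1, ∀ w ∈ Metric.closedBall (0 : ℂ) 1,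
      ‖F w - F z‖ ≤ C * ‖w - z‖ ^ α) :
    IsDiskChart α (fun z => z * segmentMean F 0 z) (segmentMean F) := by
  refine ⟨continuous_segmentMean hF, ?_, ⟨c, hc0, fun z hz w hw => ?_⟩, C, hC0, ?_⟩
  -- The slope identity holds on the open disk for any holomorphic primitive `g`; it passes to the
  -- closed disk by density, both sides being continuous.
  · obtain ⟨g, hg⟩ := hFd.isExactOn_ball
    have hf : ∀ z ∈ Metric.ball (0 : ℂ) 1, z * segmentMean F 0 z = g z - g 0 := fun z hz => by
      rw [sub_eq_mul_segmentMean hF hg (Metric.mem_ball_self one_pos) hz, sub_zero]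
    have hA := continuous_segmentMean hF
    intro z hz w hw
    have hzw : (z, w) ∈ closure (Metric.ball (0 : ℂ) 1 ×ˢ Metric.ball (0 : ℂ) 1) := by
      rw [closure_prod_eq, closure_unitBall]; exact ⟨hz, hw⟩
    have h0 : Continuous fun z => z * segmentMean F 0 z :=
      continuous_id.mul (hA.comp (continuous_const.prodMk continuous_id))
    refine EqOn.closure (f := fun p : ℂ × ℂ => p.2 * segmentMean F 0 p.2 -
      p.1 * segmentMean F 0 p.1) (g := fun p : ℂ × ℂ => (p.2 - p.1) * segmentMean F p.1 p.2)
      ?_ ?_ ?_ hzw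
    · rintro ⟨x, y⟩ ⟨hx, hy⟩
      simp only at hx hy ⊢
      rw [hf x hx, hf y hy, ← sub_eq_mul_segmentMean hF hg hx hy]
      ring
    · exact (h0.comp continuous_snd).sub (h0.comp continuous_fst)
    · exact (continuous_snd.sub continuous_fst).mul hA
  · exact (le_re_segmentMean hF hc hz hw).trans ((le_abs_self _).trans (Complex.abs_re_le_norm _))
  · simpa only [segmentMean_self] using hC

lemma IsDiskChart.affine {α : ℝ} {f : ℂ → ℂ} {A : ℂ → ℂ → ℂ} (H : IsDiskChart α f A) (a : ℂ) {κ : ℂ}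
    (hκ : ‖κ‖ = 1) : IsDiskChart α (fun z => a + κ * f z) (fun z w => κ * A z w) := by
  obtain ⟨c, hc0, hc⟩ := H.exists_le_norm
  obtain ⟨C, hC0, hC⟩ := H.holder
  refine ⟨continuous_const.mul H.continuous, fun z hz w hw => ?_, ⟨c, hc0, fun z hz w hw => ?_⟩,
    C, hC0, fun z hz w hw => ?_⟩
  · linear_combination κ * H.sub_eq z hz w hw
  · rw [norm_mul, hκ, one_mul]; exact hc z hz w hw
  · rw [← mul_sub, norm_mul, hκ, one_mul]; exact hC z hz w hw

/-! ### The image of the disk under a chart -/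

namespace IsDiskChart

variable {α : ℝ} {f : ℂ → ℂ} {A : ℂ → ℂ → ℂ}

lemma slope_ne_zero (H : IsDiskChart α f A) {z w : ℂ} (hz : z ∈ Metric.closedBall (0 : ℂ) 1)
    (hw : w ∈ Metric.closedBall (0 : ℂ) 1) : A z w ≠ 0 := by
  obtain ⟨c, hc0, hc⟩ := H.exists_le_norm
  exact norm_pos_iff.mp (hc0.trans_le (hc z hz w hw))

lemma exists_mul_norm_sub_le (H : IsDiskChart α f A) :
    ∃ c > 0, ∀ z ∈ Metric.closedBall (0 : ℂ) 1, ∀ w ∈ Metric.closedBall (0 : ℂ) 1,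
      c * ‖w - z‖ ≤ ‖f w - f z‖ := by
  obtain ⟨c, hc0, hc⟩ := H.exists_le_norm
  refine ⟨c, hc0, fun z hz w hw => ?_⟩
  rw [H.sub_eq z hz w hw, norm_mul, mul_comm]
  exact mul_le_mul_of_nonneg_left (hc z hz w hw) (norm_nonneg _)

lemma exists_norm_slope_le (H : IsDiskChart α f A) :
    ∃ M > 0, ∀ z ∈ Metric.closedBall (0 : ℂ) 1, ∀ w ∈ Metric.closedBall (0 : ℂ) 1,
      ‖A z w‖ ≤ M := by
  obtain ⟨M, hM⟩ := ((isCompact_closedBall (0 : ℂ) 1).prod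
    (isCompact_closedBall (0 : ℂ) 1)).exists_bound_of_continuousOn H.continuous.continuousOn
  exact ⟨max M 1, lt_max_of_lt_right one_pos, fun z hz w hw =>
    (hM (z, w) ⟨hz, hw⟩).trans (le_max_left _ _)⟩

lemma injOn (H : IsDiskChart α f A) : InjOn f (Metric.closedBall 0 1) := by
  intro z hz w hw h
  have := H.sub_eq z hz w hw
  rw [h, sub_self] at this
  rcases mul_eq_zero.mp this.symm with h | h
  · exact (sub_eq_zero.mp h).symm
  · exact absurd h (H.slope_ne_zero hz hw)

/-- The difference quotient at `z` is exactly `A z w`, and `A` is continuous; boundary points need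
no separate treatment. -/
lemma hasDerivWithinAt (H : IsDiskChart α f A) {z : ℂ} (hz : z ∈ Metric.closedBall (0 : ℂ) 1) :
    HasDerivWithinAt f (A z z) (Metric.closedBall 0 1) z := by
  rw [hasDerivWithinAt_iff_tendsto_slope]
  have h1 : Tendsto (fun w => A z w) (𝓝[Metric.closedBall 0 1 \ {z}] z) (𝓝 (A z z)) :=
    tendsto_nhdsWithin_of_tendsto_nhds
      ((H.continuous.comp (continuous_const.prodMk continuous_id)).tendsto z)
  refine h1.congr' ?_
  filter_upwards [self_mem_nhdsWithin] with w hw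
  have hne : w - z ≠ 0 := sub_ne_zero.mpr hw.2
  rw [slope_def_field, H.sub_eq z hz w hw.1, mul_div_cancel_left₀ _ hne]

lemma hasDerivAt (H : IsDiskChart α f A) {z : ℂ} (hz : z ∈ Metric.ball (0 : ℂ) 1) :
    HasDerivAt f (A z z) z :=
  (H.hasDerivWithinAt (Metric.ball_subset_closedBall hz)).hasDerivAt
    (Filter.mem_of_superset (Metric.isOpen_ball.mem_nhds hz) Metric.ball_subset_closedBall)

lemma continuousOn (H : IsDiskChart α f A) : ContinuousOn f (Metric.closedBall 0 1) :=
  fun _ hz => (H.hasDerivWithinAt hz).continuousWithinAt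

lemma differentiableOn (H : IsDiskChart α f A) : DifferentiableOn ℂ f (Metric.ball 0 1) :=
  fun _ hz => (H.hasDerivAt hz).differentiableAt.differentiableWithinAt

lemma isOpen_image (H : IsDiskChart α f A) : IsOpen (f '' Metric.ball 0 1) := by
  rw [isOpen_iff_mem_nhds]
  rintro _ ⟨z, hz, rfl⟩
  have h1 : HasStrictDerivAt f (deriv f z) z :=
    (H.differentiableOn.analyticAt (Metric.isOpen_ball.mem_nhds hz)).hasStrictDerivAt
  rw [(H.hasDerivAt hz).deriv] at h1
  have hb := Metric.ball_subset_closedBall hz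
  rw [← h1.map_nhds_eq (H.slope_ne_zero hb hb)]
  exact image_mem_map (Metric.isOpen_ball.mem_nhds hz)

lemma closure_image (H : IsDiskChart α f A) :
    closure (f '' Metric.ball 0 1) = f '' Metric.closedBall 0 1 := by
  refine subset_antisymm ?_ ?_
  · exact closure_minimal (image_mono Metric.ball_subset_closedBall)
      ((isCompact_closedBall (0 : ℂ) 1).image_of_continuousOn H.continuousOn).isClosed
  · have := H.continuousOn
    rw [← closure_unitBall] at this ⊢
    exact this.image_closure

lemma frontier_image (H : IsDiskChart α f A) :
    frontier (f '' Metric.ball 0 1) = f '' Metric.sphere 0 1 := by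
  rw [H.isOpen_image.frontier_eq, H.closure_image, ← H.injOn.image_sdiff_subset
    Metric.ball_subset_closedBall, Metric.closedBall_sdiff_ball]

lemma isBounded_image (H : IsDiskChart α f A) : Bornology.IsBounded (f '' Metric.ball 0 1) :=
  (((isCompact_closedBall (0 : ℂ) 1).image_of_continuousOn H.continuousOn).isBounded).subset
    (image_mono Metric.ball_subset_closedBall)

/-- The chart is uniformly continuous and has a Lipschitz inverse, so it is a homeomorphism from the
contractible open disk onto its image. -/
lemma isSimplyConnected_image (H : IsDiskChart α f A) :
    IsSimplyConnected (f '' Metric.ball 0 1) := by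
  obtain ⟨c, hc0, hc⟩ := H.exists_mul_norm_sub_le
  have hu : UniformContinuous fun z : Metric.ball (0 : ℂ) 1 => f z :=
    uniformContinuousOn_iff_restrict.mp
      (((isCompact_closedBall (0 : ℂ) 1).uniformContinuousOn_of_continuous H.continuousOn).mono
        Metric.ball_subset_closedBall)
  have ha : AntilipschitzWith (Real.toNNReal c⁻¹) fun z : Metric.ball (0 : ℂ) 1 => f z := by
    refine AntilipschitzWith.of_le_mul_dist fun z w => ?_
    have := hc w (Metric.ball_subset_closedBall w.2) z (Metric.ball_subset_closedBall z.2)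
    rw [Real.coe_toNNReal _ (inv_nonneg.mpr hc0.le), Subtype.dist_eq, dist_eq_norm, dist_eq_norm,
      ← div_eq_inv_mul, le_div_iff₀' hc0]
    exact this
  have hr : range (fun z : Metric.ball (0 : ℂ) 1 => f z) = f '' Metric.ball 0 1 := by
    ext; simp
  have : ContractibleSpace (Metric.ball (0 : ℂ) 1) :=
    (convex_ball (0 : ℂ) 1).contractibleSpace ⟨0, Metric.mem_ball_self one_pos⟩
  have e := (ha.isUniformEmbedding hu).isEmbedding.toHomeomorph.symm.toHomotopyEquiv
  rw [← hr]
  exact e.simplyConnectedSpace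

/-- The inverse of the chart, defined on the image of the closed disk. -/
noncomputable def inv (f : ℂ → ℂ) : ℂ → ℂ := Function.invFunOn f (Metric.closedBall 0 1)

lemma inv_apply (H : IsDiskChart α f A) {z : ℂ} (hz : z ∈ Metric.closedBall (0 : ℂ) 1) :
    inv f (f z) = z :=
  H.injOn.leftInvOn_invFunOn hz

/-- The inverse is Lipschitz, hence continuous, and its difference quotients are the reciprocals of
`A z w`. -/
lemma hasDerivWithinAt_inv (H : IsDiskChart α f A) {z : ℂ}
    (hz : z ∈ Metric.closedBall (0 : ℂ) 1) :
    HasDerivWithinAt (inv f) (A z z)⁻¹ (f '' Metric.closedBall 0 1) (f z) := by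
  rw [hasDerivWithinAt_iff_tendsto_slope]
  obtain ⟨c, hc0, hc⟩ := H.exists_mul_norm_sub_le
  have hcont : Tendsto (inv f) (𝓝[f '' Metric.closedBall 0 1] (f z)) (𝓝 z) := by
    rw [tendsto_iff_norm_sub_tendsto_zero]
    have h1 : Tendsto (fun ζ => c⁻¹ * ‖ζ - f z‖) (𝓝[f '' Metric.closedBall 0 1] (f z)) (𝓝 0) := by
      have : Continuous fun ζ => c⁻¹ * ‖ζ - f z‖ := by fun_prop
      refine tendsto_nhdsWithin_of_tendsto_nhds ((this.tendsto (f z)).trans_eq ?_)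
      simp
    refine squeeze_zero' (Eventually.of_forall fun _ => norm_nonneg _) ?_ h1
    filter_upwards [self_mem_nhdsWithin] with _ ⟨w, hw, hζ⟩
    rw [← hζ, H.inv_apply hw, ← div_eq_inv_mul, le_div_iff₀' hc0]
    exact hc z hz w hw
  have h2 : Tendsto (fun ζ => (A z (inv f ζ))⁻¹) (𝓝[f '' Metric.closedBall 0 1] (f z))
      (𝓝 (A z z)⁻¹) :=
    ((((H.continuous.comp (continuous_const.prodMk continuous_id)).tendsto z).comp hcont).inv₀
      (H.slope_ne_zero hz hz))
  refine (h2.mono_left (nhdsWithin_mono _ sdiff_subset)).congr' ?_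
  filter_upwards [self_mem_nhdsWithin] with _ ⟨⟨w, hw, hζ⟩, hne⟩
  have hwz : w - z ≠ 0 := sub_ne_zero.mpr fun h => hne (by rw [← hζ, h]; rfl)
  rw [slope_def_field, ← hζ, H.inv_apply hw, H.inv_apply hz, H.sub_eq z hz w hw,
    div_mul_cancel_left₀ hwz]

lemma continuousOn_inv (H : IsDiskChart α f A) :
    ContinuousOn (inv f) (f '' Metric.closedBall 0 1) := by
  rintro _ ⟨z, hz, rfl⟩
  exact (H.hasDerivWithinAt_inv hz).continuousWithinAt

end IsDiskChart

/-! ### Boundary regularity of the image -/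

namespace IsDiskChart

variable {α : ℝ} {f : ℂ → ℂ} {A : ℂ → ℂ → ℂ}

/-- The counterclockwise unit tangent at the boundary point `f z`, `|z| = 1`. -/
noncomputable def tangent (A : ℂ → ℂ → ℂ) (z : ℂ) : ℂ := Complex.I * z * (A z z / ‖A z z‖)

lemma norm_tangent (H : IsDiskChart α f A) {z : ℂ} (hz : ‖z‖ = 1) : ‖tangent A z‖ = 1 := by
  have hz' : z ∈ Metric.closedBall (0 : ℂ) 1 := mem_closedBall_zero_iff.mpr hz.le
  have := norm_ne_zero_iff.mpr (H.slope_ne_zero hz' hz')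
  rw [tangent, norm_mul, norm_mul, Complex.norm_I, hz, norm_div, Complex.norm_real, norm_norm,
    div_self this, one_mul, one_mul]

/-- Moving from a boundary point near `f z₀` in the direction of the inner normal at `f z₀` leads
to images of points of the open disk, and never in the opposite direction. -/
lemma exists_radius_normal (H : IsDiskChart α f A) {z₀ : ℂ} (hz₀ : ‖z₀‖ = 1) :
    ∃ ρ > 0, ∀ z w : ℂ, ‖z‖ = 1 → ‖w‖ ≤ 1 → ‖z - z₀‖ < ρ → ‖w - z₀‖ < ρ → ∀ s : ℝ,
      f w - f z = s * (Complex.I * tangent A z₀) → (0 < s → ‖w‖ < 1) ∧ 0 ≤ s := by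
  have hz₀' : z₀ ∈ Metric.closedBall (0 : ℂ) 1 := mem_closedBall_zero_iff.mpr hz₀.le
  have h0 := H.slope_ne_zero hz₀' hz₀'
  have hconj : ∀ z : ℂ, ‖z‖ = 1 → z * (starRingEnd ℂ) z = 1 := fun z hz => by
    rw [Complex.mul_conj, Complex.normSq_eq_norm_sq, hz]; simp
  -- `B` compares the inner normal pulled back at `(z, w)` with the radial direction: it equals `1`
  -- at `(z₀, z₀)` and turns the hypothesis into `w = z (1 - σ B(z, w))`.
  set B : ℂ × ℂ → ℂ := fun p => z₀ * (starRingEnd ℂ) p.1 * (A z₀ z₀ / A p.1 p.2) with hB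
  have hBc : ContinuousAt B (z₀, z₀) := by
    refine ContinuousAt.mul (by fun_prop) (continuousAt_const.div H.continuous.continuousAt h0)
  have hB0 : B (z₀, z₀) = 1 := by
    simp only [hB]
    rw [hconj z₀ hz₀, div_self h0, one_mul]
  obtain ⟨ρ, hρ0, hρ⟩ := Metric.continuousAt_iff.mp hBc (1 / 2) (by norm_num)
  -- The radius `1/3` gives `|σ| |b| = |w - z| < 2/3`; with `|b| ≤ 3/2` and `Re b > 1/2`, the linear
  -- term of `|w|² = 1 - 2σ Re b + σ²|b|²` dominates when `σ > 0`.
  refine ⟨min ρ (1 / 3), by positivity, fun z w hz hw hzρ hwρ s hs => ?_⟩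
  have hz' : z ∈ Metric.closedBall (0 : ℂ) 1 := mem_closedBall_zero_iff.mpr hz.le
  have hw' : w ∈ Metric.closedBall (0 : ℂ) 1 := mem_closedBall_zero_iff.mpr hw
  have hA := H.slope_ne_zero hz' hw'
  have hBn : ‖B (z, w) - 1‖ < 1 / 2 := by
    rw [← hB0, ← dist_eq_norm]
    refine hρ ?_
    rw [Prod.dist_eq, max_lt_iff, dist_eq_norm, dist_eq_norm]
    exact ⟨hzρ.trans_le (min_le_left _ _), hwρ.trans_le (min_le_left _ _)⟩
  set b := B (z, w)
  set σ := s / ‖A z₀ z₀‖ with hσ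
  have hn0 : (‖A z₀ z₀‖ : ℂ) ≠ 0 := by exact_mod_cast norm_ne_zero_iff.mpr h0
  have hwz : w = z * (1 - σ * b) := by
    have e1 := H.sub_eq z hz' w hw'
    rw [hs, tangent] at e1
    have e2 : (w - z) = -(σ * b) * z := by
      have e3 : (w - z) = (s * (Complex.I * (Complex.I * z₀ * (A z₀ z₀ / ‖A z₀ z₀‖)))) / A z w := by
        rw [e1, mul_div_cancel_right₀ _ hA]
      rw [e3, show b = z₀ * (starRingEnd ℂ) z * (A z₀ z₀ / A z w) from rfl, hσ]
      push_cast
      field_simp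
      linear_combination s * z₀ * Complex.I_sq + s * z₀ * hconj z hz
    linear_combination e2
  have hre : 1 / 2 < b.re := by
    have := (Complex.abs_re_le_norm (b - 1)).trans_lt hBn
    rw [Complex.sub_re, Complex.one_re, abs_lt] at this
    linarith
  have hbn : ‖b‖ ≤ 3 / 2 := by
    have := norm_le_norm_sub_add b 1
    rw [norm_one] at this
    linarith
  have hsq : ‖w‖ ^ 2 = 1 - 2 * σ * b.re + σ ^ 2 * ‖b‖ ^ 2 := by
    rw [hwz, norm_mul, hz, one_mul]
    simp only [Complex.sq_norm, Complex.normSq_apply, Complex.sub_re, Complex.sub_im,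
      Complex.re_ofReal_mul, Complex.im_ofReal_mul, Complex.one_re, Complex.one_im]
    ring
  have hσb : |σ| * ‖b‖ < 2 / 3 := by
    have e : w - z = -(σ * b) * z := by rw [hwz]; ring
    have e2 : ‖w - z‖ = |σ| * ‖b‖ := by
      rw [e, norm_mul, hz, mul_one, norm_neg, norm_mul, Complex.norm_real, Real.norm_eq_abs]
    rw [← e2]
    have h1 := norm_sub_le_norm_sub_add_norm_sub w z₀ z
    rw [norm_sub_rev z₀ z] at h1
    have h2 := hzρ.trans_le (min_le_right _ _)
    have h3 := hwρ.trans_le (min_le_right _ _)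
    linarith
  have hA0 : 0 < ‖A z₀ z₀‖ := norm_pos_iff.mpr h0
  refine ⟨fun hs0 => ?_, ?_⟩
  · have hσ0 : 0 < σ := div_pos hs0 hA0
    rw [abs_of_pos hσ0] at hσb
    have h1 : σ ^ 2 * ‖b‖ ^ 2 < 2 * σ * b.re := by
      have h2 : σ * ‖b‖ * ‖b‖ ≤ 1 := by nlinarith [norm_nonneg b]
      nlinarith
    exact (sq_lt_one_iff₀ (norm_nonneg w)).mp (by linarith)
  · by_contra! hs0
    have hσ0 : σ < 0 := div_neg_of_neg_of_pos hs0 hA0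
    have h1 : ‖w‖ ^ 2 ≤ 1 := pow_le_one₀ (norm_nonneg _) hw
    nlinarith [sq_nonneg (σ * ‖b‖)]

end IsDiskChart

/-- The local inverse of a real function with derivative bounded below by `m > 0`. -/
lemma exists_inverse_of_le_deriv {X X' : ℝ → ℝ} (hX : ∀ t, HasDerivAt X (X' t) t) (h0 : X 0 = 0)
    {τ m : ℝ} (hτ : 0 < τ) (hm : 0 < m) (hX' : ∀ t ∈ Icc (-τ) τ, m ≤ X' t) :
    ∃ T : ℝ → ℝ, (∀ x ∈ Ioo (-(m * τ)) (m * τ), T x ∈ Icc (-τ) τ ∧ X (T x) = x ∧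
        HasDerivAt T (X' (T x))⁻¹ x) ∧ T 0 = 0 ∧
      ∀ x ∈ Ioo (-(m * τ)) (m * τ), ∀ y ∈ Ioo (-(m * τ)) (m * τ), |T x - T y| ≤ m⁻¹ * |x - y| := by
  have hmono : ∀ s ∈ Icc (-τ) τ, ∀ t ∈ Icc (-τ) τ, s ≤ t → m * (t - s) ≤ X t - X s :=
    fun s hs t ht hst => (convex_Icc (-τ) τ).mul_sub_le_image_sub_of_le_deriv
      (fun u _ => (hX u).continuousAt.continuousWithinAt)
      (fun u _ => (hX u).differentiableAt.differentiableWithinAt)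
      (fun u hu => by rw [(hX u).deriv]; exact hX' u (interior_subset hu)) s hs t ht hst
  have habs : ∀ s ∈ Icc (-τ) τ, ∀ t ∈ Icc (-τ) τ, m * |t - s| ≤ |X t - X s| := by
    intro s hs t ht
    rcases le_total s t with h | h
    · rw [abs_of_nonneg (sub_nonneg.mpr h)]
      exact (hmono s hs t ht h).trans (le_abs_self _)
    · rw [abs_sub_comm, abs_of_nonneg (sub_nonneg.mpr h), abs_sub_comm]
      exact (hmono t ht s hs h).trans (le_abs_self _)
  have h0m : (0 : ℝ) ∈ Icc (-τ) τ := ⟨by linarith, hτ.le⟩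
  have hsurj : ∀ x, ∃ t, x ∈ Ioo (-(m * τ)) (m * τ) → t ∈ Icc (-τ) τ ∧ X t = x := by
    intro x
    by_cases hx : x ∈ Ioo (-(m * τ)) (m * τ)
    · have h1 := hmono 0 h0m τ ⟨by linarith, le_rfl⟩ hτ.le
      have h2 := hmono (-τ) ⟨le_rfl, by linarith⟩ 0 h0m (by linarith)
      have hc : ContinuousOn X (Icc (-τ) τ) := fun u _ => (hX u).continuousAt.continuousWithinAt
      obtain ⟨t, ht, hxt⟩ := intermediate_value_Icc (by linarith) hc
        (show x ∈ Icc (X (-τ)) (X τ) from ⟨by nlinarith [hx.1], by nlinarith [hx.2]⟩)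
      exact ⟨t, fun _ => ⟨ht, hxt⟩⟩
    · exact ⟨0, fun h => absurd h hx⟩
  choose T hT using hsurj
  have hlip : ∀ x ∈ Ioo (-(m * τ)) (m * τ), ∀ y ∈ Ioo (-(m * τ)) (m * τ),
      |T x - T y| ≤ m⁻¹ * |x - y| := by
    intro x hx y hy
    have := habs _ (hT y hy).1 _ (hT x hx).1
    rw [(hT x hx).2, (hT y hy).2] at this
    rwa [← div_eq_inv_mul, le_div_iff₀' hm]
  refine ⟨T, fun x hx => ⟨(hT x hx).1, (hT x hx).2, ?_⟩, ?_, hlip⟩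
  · have hnhds : Ioo (-(m * τ)) (m * τ) ∈ 𝓝 x := isOpen_Ioo.mem_nhds hx
    refine HasDerivAt.of_local_left_inverse ?_ (hX (T x))
      (hm.trans_le (hX' _ (hT x hx).1)).ne' (Filter.mem_of_superset hnhds fun y hy => (hT y hy).2)
    rw [ContinuousAt, tendsto_iff_norm_sub_tendsto_zero]
    have h1 : Tendsto (fun y => m⁻¹ * |y - x|) (𝓝 x) (𝓝 0) := by
      have : Continuous fun y => m⁻¹ * |y - x| := by fun_prop
      refine (this.tendsto x).trans_eq ?_
      simp
    exact squeeze_zero' (Eventually.of_forall fun _ => norm_nonneg _)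
      (Filter.mem_of_superset hnhds fun y hy => hlip y hy x hx) h1
  · have h00 : (0 : ℝ) ∈ Ioo (-(m * τ)) (m * τ) := ⟨by nlinarith, by positivity⟩
    have := habs 0 h0m _ (hT 0 h00).1
    rw [(hT 0 h00).2, h0, sub_self, abs_zero, sub_zero] at this
    exact abs_eq_zero.mp (le_antisymm (by nlinarith [abs_nonneg (T 0)]) (abs_nonneg _))

namespace IsDiskChart

variable {α : ℝ} {f : ℂ → ℂ} {A : ℂ → ℂ → ℂ}

lemma hasDerivAt_boundary (H : IsDiskChart α f A) {z₀ : ℂ} (hz₀ : ‖z₀‖ = 1) (t : ℝ) :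
    HasDerivAt (fun t : ℝ => f (z₀ * Complex.exp (t * Complex.I)))
      (Complex.I * (z₀ * Complex.exp (t * Complex.I)) *
        A (z₀ * Complex.exp (t * Complex.I)) (z₀ * Complex.exp (t * Complex.I))) t := by
  have hmem : ∀ t : ℝ, z₀ * Complex.exp (t * Complex.I) ∈ Metric.closedBall (0 : ℂ) 1 := fun t => by
    rw [mem_closedBall_zero_iff, norm_mul, hz₀, Complex.norm_exp_ofReal_mul_I, one_mul]
  have h0 : HasDerivAt (fun t : ℝ => z₀ * Complex.exp (t * Complex.I))
      (z₀ * (Complex.exp (t * Complex.I) * (1 * Complex.I))) t :=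
    (((Complex.ofRealCLM.hasDerivAt (x := t)).mul_const Complex.I).cexp).const_mul z₀
  refine ((H.hasDerivWithinAt (hmem t)).scomp_hasDerivAt t h0 hmem).congr_deriv ?_
  rw [smul_eq_mul]
  ring

lemma norm_exp_sub_exp_le (s t : ℝ) :
    ‖Complex.exp (t * Complex.I) - Complex.exp (s * Complex.I)‖ ≤ |t - s| := by
  have e : Complex.exp (t * Complex.I) - Complex.exp (s * Complex.I) =
      Complex.exp (s * Complex.I) * (Complex.exp (Complex.I * (t - s : ℝ)) - 1) := by
    rw [mul_sub, ← Complex.exp_add]; push_cast; ring_nf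
  rw [e, norm_mul, Complex.norm_exp_ofReal_mul_I, one_mul]
  exact Real.norm_exp_I_mul_ofReal_sub_one_le

/-- Near a boundary point, in the coordinates given by the tangent and the inner normal there, the
image of the disk is the strict epigraph of a `C^{1,α}` function. -/
theorem exists_epigraph (H : IsDiskChart α f A) (hα0 : 0 < α) (hα1 : α ≤ 1) {z₀ : ℂ}
    (hz₀ : ‖z₀‖ = 1) :
    ∃ (δ η : ℝ) (g : ℝ → ℝ) (C : ℝ), 0 < δ ∧ 0 < η ∧ 0 ≤ C ∧ g 0 = 0 ∧
      (∀ x ∈ Ioo (-δ) δ, DifferentiableAt ℝ g x) ∧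
      (∀ x ∈ Ioo (-δ) δ, ∀ y ∈ Ioo (-δ) δ, |deriv g x - deriv g y| ≤ C * |x - y| ^ α) ∧
      ∀ x ∈ Ioo (-δ) δ, ∀ y ∈ Ioo (-η) η,
        (f z₀ + ((x : ℂ) + (y : ℂ) * Complex.I) * tangent A z₀ ∈ f '' Metric.ball 0 1 ↔
          g x < y) := by
  have hz₀' : z₀ ∈ Metric.closedBall (0 : ℂ) 1 := mem_closedBall_zero_iff.mpr hz₀.le
  have hA0 := H.slope_ne_zero hz₀' hz₀'
  have hA0n : 0 < ‖A z₀ z₀‖ := norm_pos_iff.mpr hA0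
  set e := tangent A z₀ with he
  have hen : ‖e‖ = 1 := H.norm_tangent hz₀
  have he0 : e ≠ 0 := norm_pos_iff.mp (by rw [hen]; exact one_pos)
  obtain ⟨ρ, hρ0, hρ⟩ := H.exists_radius_normal hz₀
  obtain ⟨c, hc0, hc⟩ := H.exists_mul_norm_sub_le
  obtain ⟨M, hM0, hM⟩ := H.exists_norm_slope_le
  obtain ⟨C, hC0, hC⟩ := H.holder
  set ζ : ℝ → ℂ := fun t => z₀ * Complex.exp (t * Complex.I) with hζ
  have hζn : ∀ t, ‖ζ t‖ = 1 := fun t => by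
    rw [hζ, norm_mul, hz₀, Complex.norm_exp_ofReal_mul_I, one_mul]
  have hζm : ∀ t, ζ t ∈ Metric.closedBall (0 : ℂ) 1 := fun t =>
    mem_closedBall_zero_iff.mpr (hζn t).le
  have hζ0 : ζ 0 = z₀ := by simp [hζ]
  have hζlip : ∀ s t, ‖ζ t - ζ s‖ ≤ |t - s| := fun s t => by
    rw [hζ, ← mul_sub, norm_mul, hz₀, one_mul]
    exact norm_exp_sub_exp_le s t
  -- The boundary curve in coordinates with origin `f z₀` and axes along the tangent `e` and the
  -- inner normal `i e`. Its velocity `D` is real and positive at `t = 0`, so the abscissa can serve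
  -- as parameter nearby.
  set γ : ℝ → ℂ := fun t => (f (ζ t) - f z₀) / e with hγ
  set D : ℝ → ℂ := fun t => Complex.I * ζ t * A (ζ t) (ζ t) / e with hD
  have hγD : ∀ t, HasDerivAt γ (D t) t := fun t =>
    ((H.hasDerivAt_boundary hz₀ t).sub_const (f z₀)).div_const e
  have hγ0 : γ 0 = 0 := by simp [hγ, hζ0]
  have hγn : ∀ t, ‖γ t‖ ≤ M * |t| := fun t => by
    rw [hγ, norm_div, hen, div_one, H.sub_eq z₀ hz₀' (ζ t) (hζm t), norm_mul, mul_comm]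
    have := hζlip 0 t
    rw [hζ0, sub_zero] at this
    exact mul_le_mul (hM _ hz₀' _ (hζm t)) this (norm_nonneg _) hM0.le
  have hX : ∀ t, HasDerivAt (fun t => (γ t).re) (D t).re t := fun t => by
    exact Complex.reCLM.hasFDerivAt.comp_hasDerivAt t (hγD t)
  have hY : ∀ t, HasDerivAt (fun t => (γ t).im) (D t).im t := fun t => by
    exact Complex.imCLM.hasFDerivAt.comp_hasDerivAt t (hγD t)
  have hD0 : D 0 = ‖A z₀ z₀‖ := by
    have hz0 : z₀ ≠ 0 := norm_pos_iff.mp (by rw [hz₀]; exact one_pos)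
    have : (‖A z₀ z₀‖ : ℂ) ≠ 0 := by exact_mod_cast hA0n.ne'
    simp only [hD, hζ0, he, tangent]
    field_simp
  have hDn : ∀ t, ‖D t‖ ≤ M := fun t => by
    rw [hD, norm_div, hen, div_one, norm_mul, norm_mul, Complex.norm_I, hζn, one_mul, one_mul]
    exact hM _ (hζm t) _ (hζm t)
  have hDh : ∀ s t, |t - s| ≤ 1 → ‖D t - D s‖ ≤ (M + C) * |t - s| ^ α := by
    intro s t hst
    have e1 : D t - D s = Complex.I * ((ζ t - ζ s) * A (ζ t) (ζ t) +
        ζ s * (A (ζ t) (ζ t) - A (ζ s) (ζ s))) / e := by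
      simp only [hD]; ring
    have h1 : |t - s| ≤ |t - s| ^ α := by
      simpa using Real.rpow_le_rpow_of_exponent_ge' (abs_nonneg (t - s)) hst hα0.le hα1
    have h2 : ‖ζ t - ζ s‖ ^ α ≤ |t - s| ^ α :=
      Real.rpow_le_rpow (norm_nonneg _) (hζlip s t) hα0.le
    rw [e1, norm_div, hen, div_one, norm_mul, Complex.norm_I, one_mul, add_mul]
    refine (norm_add_le _ _).trans (add_le_add ?_ ?_)
    · rw [norm_mul, mul_comm]
      exact mul_le_mul (hM _ (hζm t) _ (hζm t)) ((hζlip s t).trans h1) (norm_nonneg _) hM0.le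
    · rw [norm_mul, hζn, one_mul]
      exact (hC _ (hζm s) _ (hζm t)).trans (mul_le_mul_of_nonneg_left h2 hC0)
  set m := ‖A z₀ z₀‖ / 2 with hm
  have hm0 : 0 < m := by positivity
  -- a parameter interval on which the abscissa has derivative at least `m`
  have hDc : Continuous D := by
    have hζc : Continuous ζ := by fun_prop
    exact ((continuous_const.mul hζc).mul
      (H.continuous.comp (hζc.prodMk hζc))).div_const e
  obtain ⟨τ₁, hτ₁0, hτ₁⟩ : ∃ τ₁ > 0, ∀ t, |t| < τ₁ → m < (D t).re := by
    have h1 : m < (D 0).re := by rw [hD0, Complex.ofReal_re]; linarith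
    have := (Complex.continuous_re.comp hDc).continuousAt.eventually
      (isOpen_Ioi.mem_nhds (show (D 0).re ∈ Ioi m from h1))
    obtain ⟨ε, hε, h⟩ := Metric.eventually_nhds_iff.mp this
    exact ⟨ε, hε, fun t ht => h (by rwa [Real.dist_eq, sub_zero])⟩
  -- The three constraints: the abscissa has derivative at least `m`; two parameters differ by at
  -- most `1`, so that `|t - s| ≤ |t - s|^α`; the boundary points stay within `ρ` of `z₀`.
  set τ := min (τ₁ / 2) (min (1 / 2) (ρ / 2)) with hτ
  have hτ0 : 0 < τ := by positivity
  have hττ₁ : τ < τ₁ := (min_le_left _ _).trans_lt (by linarith)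
  have hτ1 : τ ≤ 1 / 2 := (min_le_right _ _).trans (min_le_left _ _)
  have hτρ : τ < ρ := ((min_le_right _ _).trans (min_le_right _ _)).trans_lt (by linarith)
  have hDm : ∀ t ∈ Icc (-τ) τ, m ≤ (D t).re := fun t ht =>
    (hτ₁ t ((abs_le.mpr ht).trans_lt hττ₁)).le
  obtain ⟨T, hT, hT0, hTlip⟩ := exists_inverse_of_le_deriv hX (by rw [hγ0, Complex.zero_re]) hτ0 hm0
    hDm
  -- the size of the rectangle
  set η := c * ρ / 4 with hη
  have hη0 : 0 < η := by positivity
  -- The terms of `δ` ensure, in turn, that the inverse `T` is defined, that preimages of points of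
  -- the rectangle lie within `ρ` of `z₀`, and that `|g| < η`.
  set δ := min (m * τ) (min (c * ρ / 4) (η * m / M)) with hδ
  have hδ0 : 0 < δ := by positivity
  have hδτ : ∀ x ∈ Ioo (-δ) δ, x ∈ Ioo (-(m * τ)) (m * τ) := fun x hx =>
    ⟨by linarith [hx.1, min_le_left (m * τ) (min (c * ρ / 4) (η * m / M))],
      by linarith [hx.2, min_le_left (m * τ) (min (c * ρ / 4) (η * m / M))]⟩
  have hδc : δ ≤ c * ρ / 4 := (min_le_right _ _).trans (min_le_left _ _)
  have hδη : δ ≤ η * m / M := (min_le_right _ _).trans (min_le_right _ _)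
  have h0δ : (0 : ℝ) ∈ Ioo (-(m * τ)) (m * τ) := hδτ 0 ⟨by linarith, hδ0⟩
  set g : ℝ → ℝ := fun x => (γ (T x)).im with hg
  have hgd : ∀ x ∈ Ioo (-δ) δ, HasDerivAt g ((D (T x)).im * (D (T x)).re⁻¹) x := fun x hx =>
    (hY (T x)).comp x (hT x (hδτ x hx)).2.2
  have hfT : ∀ x ∈ Ioo (-δ) δ, f (ζ (T x)) = f z₀ + ((x : ℂ) + (g x : ℂ) * Complex.I) * e := by
    intro x hx
    have h1 : γ (T x) = (x : ℂ) + (g x : ℂ) * Complex.I := by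
      rw [← Complex.re_add_im (γ (T x)), (hT x (hδτ x hx)).2.1]
    rw [← h1]
    simp only [hγ]
    rw [div_mul_cancel₀ _ he0]
    ring
  have hζT : ∀ x ∈ Ioo (-δ) δ, ‖ζ (T x) - z₀‖ < ρ := fun x hx => by
    have h1 := hζlip 0 (T x)
    rw [hζ0, sub_zero] at h1
    exact (h1.trans (abs_le.mpr (hT x (hδτ x hx)).1)).trans_lt hτρ
  have hclose : ∀ x ∈ Ioo (-δ) δ, ∀ y ∈ Ioo (-η) η, ∀ w ∈ Metric.closedBall (0 : ℂ) 1,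
      f w = f z₀ + ((x : ℂ) + (y : ℂ) * Complex.I) * e → ‖w - z₀‖ < ρ := by
    intro x hx y hy w hw hfw
    have h1 := hc z₀ hz₀' w hw
    rw [hfw, add_sub_cancel_left, norm_mul, hen, mul_one] at h1
    have h2 : ‖(x : ℂ) + (y : ℂ) * Complex.I‖ ≤ |x| + |y| := by
      refine (norm_add_le _ _).trans ?_
      rw [norm_mul, Complex.norm_I, mul_one, Complex.norm_real, Complex.norm_real,
        Real.norm_eq_abs, Real.norm_eq_abs]
    have h3 := abs_lt.mpr hx
    have h4 := abs_lt.mpr hy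
    have h5 : c * ‖w - z₀‖ < c * ρ := by nlinarith
    exact lt_of_mul_lt_mul_left h5 hc0.le
  have hdiff : ∀ x ∈ Ioo (-δ) δ, ∀ y : ℝ, ∀ w : ℂ,
      f w = f z₀ + ((x : ℂ) + (y : ℂ) * Complex.I) * e →
      f w - f (ζ (T x)) = ((y - g x : ℝ) : ℂ) * (Complex.I * e) := by
    intro x hx y w hfw
    rw [hfw, hfT x hx]; push_cast; ring
  have himp : ∀ x ∈ Ioo (-δ) δ, ∀ y ∈ Ioo (-η) η,
      f z₀ + ((x : ℂ) + (y : ℂ) * Complex.I) * e ∈ f '' Metric.ball 0 1 → g x < y := by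
    rintro x hx y hy ⟨w, hw, hfw⟩
    have hw1 := Metric.ball_subset_closedBall hw
    have h1 := (hρ (ζ (T x)) w (hζn _) (mem_closedBall_zero_iff.mp hw1) (hζT x hx)
      (hclose x hx y hy w hw1 hfw) (y - g x) (hdiff x hx y w hfw)).2
    refine lt_of_le_of_ne (by linarith) fun heq => ?_
    have h2 : f w = f (ζ (T x)) := by rw [hfw, hfT x hx, heq]
    have h3 := H.injOn hw1 (hζm _) h2
    have h4 := mem_ball_zero_iff.mp hw
    rw [h3, hζn] at h4
    exact lt_irrefl _ h4
  have hfront : ∀ x ∈ Ioo (-δ) δ, ∀ y ∈ Ioo (-η) η, g x < y →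
      f z₀ + ((x : ℂ) + (y : ℂ) * Complex.I) * e ∉ frontier (f '' Metric.ball 0 1) := by
    intro x hx y hy hgy hmem
    rw [H.frontier_image] at hmem
    obtain ⟨w, hw, hfw⟩ := hmem
    have hw1 := Metric.sphere_subset_closedBall hw
    have h1 := (hρ (ζ (T x)) w (hζn _) (mem_closedBall_zero_iff.mp hw1) (hζT x hx)
      (hclose x hx y hy w hw1 hfw) (y - g x) (hdiff x hx y w hfw)).1 (by linarith)
    rw [mem_sphere_zero_iff_norm.mp hw] at h1
    exact lt_irrefl _ h1
  have hgη : ∀ x ∈ Ioo (-δ) δ, |g x| < η := by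
    intro x hx
    have h1 := hTlip x (hδτ x hx) 0 h0δ
    rw [hT0, sub_zero, sub_zero] at h1
    have h2 : |x| < η * m / M := (abs_lt.mpr hx).trans_le hδη
    calc |g x| ≤ ‖γ (T x)‖ := Complex.abs_im_le_norm _
      _ ≤ M * |T x| := hγn _
      _ ≤ M * (m⁻¹ * |x|) := by gcongr
      _ < M * (m⁻¹ * (η * m / M)) := by gcongr
      _ = η := by field_simp
  have hgc : ContinuousOn g (Ioo (-δ) δ) := fun x hx => (hgd x hx).continuousAt.continuousWithinAt
  -- the part of the rectangle above the graph is connected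
  set J : Set ℂ := (fun p : ℝ × ℝ =>
      f z₀ + ((p.1 : ℂ) + ((g p.1 + p.2 * (η - g p.1) : ℝ) : ℂ) * Complex.I) * e) ''
      (Ioo (-δ) δ ×ˢ Ioo (0 : ℝ) 1) with hJ
  have hJpre : IsPreconnected J := by
    refine (isPreconnected_Ioo.prod isPreconnected_Ioo).image _ ?_
    have hg1 : ContinuousOn (fun p : ℝ × ℝ => g p.1) (Ioo (-δ) δ ×ˢ Ioo (0 : ℝ) 1) :=
      hgc.comp continuousOn_fst fun p hp => hp.1
    have h2 : ContinuousOn (fun p : ℝ × ℝ => ((g p.1 + p.2 * (η - g p.1) : ℝ) : ℂ))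
        (Ioo (-δ) δ ×ˢ Ioo (0 : ℝ) 1) :=
      Complex.continuous_ofReal.comp_continuousOn
        (hg1.add (continuousOn_snd.mul (continuousOn_const.sub hg1)))
    have h3 : ContinuousOn (fun p : ℝ × ℝ => ((p.1 : ℝ) : ℂ)) (Ioo (-δ) δ ×ˢ Ioo (0 : ℝ) 1) :=
      Complex.continuous_ofReal.comp_continuousOn continuousOn_fst
    exact continuousOn_const.add ((h3.add (h2.mul continuousOn_const)).mul continuousOn_const)
  have hmemJ : ∀ x ∈ Ioo (-δ) δ, ∀ y ∈ Ioo (-η) η, g x < y →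
      f z₀ + ((x : ℂ) + (y : ℂ) * Complex.I) * e ∈ J := by
    intro x hx y hy hgy
    have h1 : 0 < η - g x := by linarith [(abs_lt.mp (hgη x hx)).2]
    refine ⟨(x, (y - g x) / (η - g x)), ⟨hx, ?_, ?_⟩, ?_⟩
    · exact div_pos (by linarith) h1
    · rw [div_lt_one h1]; linarith [hy.2]
    · simp only
      rw [div_mul_cancel₀ _ h1.ne', add_sub_cancel]
  have hJfront : J ∩ frontier (f '' Metric.ball 0 1) = ∅ := by
    rw [eq_empty_iff_forall_notMem]
    rintro _ ⟨⟨⟨x, l⟩, ⟨hx, hl0, hl1⟩, rfl⟩, hmem⟩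
    have h1 := abs_lt.mp (hgη x hx)
    simp only at hx hl0 hl1
    refine hfront x hx (g x + l * (η - g x)) ⟨by nlinarith, by nlinarith⟩ ?_ hmem
    have : 0 < l * (η - g x) := mul_pos hl0 (by linarith)
    linarith
  -- Images of the radial points `(1 - s) z₀` tend to `f z₀`, so they enter the rectangle; by `himp`
  -- they lie above the graph.
  have hJne : (J ∩ f '' Metric.ball 0 1).Nonempty := by
    have h1 : Tendsto (fun s : ℝ => (f (((1 - s : ℝ) : ℂ) * z₀) - f z₀) / e) (𝓝[Icc 0 1] 0)
        (𝓝 0) := by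
      have hcont : ContinuousOn (fun s : ℝ => (f (((1 - s : ℝ) : ℂ) * z₀) - f z₀) / e)
          (Icc 0 1) := by
        refine ((H.continuousOn.comp (by fun_prop) ?_).sub continuousOn_const).div_const e
        intro s hs
        rw [mem_closedBall_zero_iff, norm_mul, hz₀, mul_one, Complex.norm_real, Real.norm_eq_abs,
          abs_le]
        constructor <;> linarith [hs.1, hs.2]
      have := hcont 0 ⟨le_rfl, zero_le_one⟩
      simpa [ContinuousWithinAt] using this
    have h2 : ∀ᶠ s : ℝ in 𝓝[Icc 0 1] 0,
        ‖(f (((1 - s : ℝ) : ℂ) * z₀) - f z₀) / e‖ < min δ η := by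
      have := h1.norm
      rw [norm_zero] at this
      exact this.eventually (gt_mem_nhds (lt_min hδ0 hη0))
    rw [eventually_nhdsWithin_iff, Metric.eventually_nhds_iff] at h2
    obtain ⟨ε, hε, h3⟩ := h2
    set s := min (ε / 2) 1 with hs
    have hs0 : 0 < s := by positivity
    have hs1 : s ≤ 1 := min_le_right _ _
    have hsε : s < ε := (min_le_left _ _).trans_lt (by linarith)
    have h4 := h3 (y := s) (by rwa [Real.dist_eq, sub_zero, abs_of_pos hs0]) ⟨hs0.le, hs1⟩
    set q := (f (((1 - s : ℝ) : ℂ) * z₀) - f z₀) / e with hq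
    have hmem : f (((1 - s : ℝ) : ℂ) * z₀) ∈ f '' Metric.ball 0 1 := by
      refine mem_image_of_mem f ?_
      rw [mem_ball_zero_iff, norm_mul, hz₀, mul_one, Complex.norm_real, Real.norm_eq_abs,
        abs_of_nonneg (by linarith)]
      linarith
    have hfq : f (((1 - s : ℝ) : ℂ) * z₀) = f z₀ + ((q.re : ℂ) + (q.im : ℂ) * Complex.I) * e := by
      rw [Complex.re_add_im, hq, div_mul_cancel₀ _ he0]; ring
    have hx := abs_lt.mp (((Complex.abs_re_le_norm q).trans_lt h4).trans_le (min_le_left _ _))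
    have hy := abs_lt.mp (((Complex.abs_im_le_norm q).trans_lt h4).trans_le (min_le_right _ _))
    refine ⟨_, ?_, hmem⟩
    rw [hfq] at hmem ⊢
    exact hmemJ q.re hx q.im hy (himp q.re hx q.im hy hmem)
  -- A connected set that misses the frontier and meets the domain lies inside the domain.
  have hJsub : J ⊆ f '' Metric.ball 0 1 := by
    have hcover : J ⊆ f '' Metric.ball 0 1 ∪ (closure (f '' Metric.ball 0 1))ᶜ := by
      intro q hq
      by_contra! hnot
      rw [mem_union, not_or, notMem_compl_iff] at hnot
      have : q ∈ J ∩ frontier (f '' Metric.ball 0 1) :=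
        ⟨hq, by rw [H.isOpen_image.frontier_eq]; exact ⟨hnot.2, hnot.1⟩⟩
      rw [hJfront] at this
      exact this
    rcases IsPreconnected.subset_or_subset H.isOpen_image isClosed_closure.isOpen_compl
      (disjoint_compl_right.mono_left subset_closure) hcover hJpre with h | h
    · exact h
    · obtain ⟨q, hq, hq'⟩ := hJne
      exact absurd (subset_closure hq') (h hq)
  refine ⟨δ, η, g, (M + C) * M * (m⁻¹ ^ 2 * m⁻¹ ^ α), hδ0, hη0, by positivity, ?_,
    fun x hx => (hgd x hx).differentiableAt, fun x hx y hy => ?_, fun x hx y hy =>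
      ⟨himp x hx y hy, fun h => hJsub (hmemJ x hx y hy h)⟩⟩
  · simp only [hg, hT0, hγ0, Complex.zero_im]
  · rw [(hgd x hx).deriv, (hgd y hy).deriv]
    have hTx := (hT x (hδτ x hx)).1
    have hTy := (hT y (hδτ y hy)).1
    have hxr := hDm _ hTx
    have hyr := hDm _ hTy
    set a := D (T x)
    set b := D (T y)
    have ha0 : 0 < a.re := hm0.trans_le hxr
    have hb0 : 0 < b.re := hm0.trans_le hyr
    -- The slope of the graph is `Im D / Re D`. Over a common denominator the difference of two
    -- slopes is controlled by `|a - b|`, which is Hölder, while both real parts are at least `m`.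
    have e1 : a.im * a.re⁻¹ - b.im * b.re⁻¹ =
        ((a - b) * (starRingEnd ℂ) b).im * (a.re⁻¹ * b.re⁻¹) := by
      rw [Complex.mul_im, Complex.conj_re, Complex.conj_im, Complex.sub_re, Complex.sub_im]
      field_simp
      ring
    have h1 : |T x - T y| ≤ 1 := by
      rw [abs_le]; constructor <;> linarith [hTx.1, hTx.2, hTy.1, hTy.2]
    have h2 : ‖a - b‖ ≤ (M + C) * (m⁻¹ ^ α * |x - y| ^ α) := by
      refine (hDh _ _ h1).trans ?_
      rw [← Real.mul_rpow (by positivity) (abs_nonneg _)]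
      gcongr
      exact hTlip x (hδτ x hx) y (hδτ y hy)
    have h3 : |((a - b) * (starRingEnd ℂ) b).im| ≤ (M + C) * (m⁻¹ ^ α * |x - y| ^ α) * M := by
      refine (Complex.abs_im_le_norm _).trans ?_
      rw [norm_mul, Complex.norm_conj]
      exact mul_le_mul h2 (hDn _) (norm_nonneg _) ((norm_nonneg _).trans h2)
    rw [e1, abs_mul, abs_of_pos (by positivity : 0 < a.re⁻¹ * b.re⁻¹)]
    calc _ ≤ (M + C) * (m⁻¹ ^ α * |x - y| ^ α) * M * (m⁻¹ * m⁻¹) := by gcongr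
      _ = _ := by ring

end IsDiskChart

/-! ### The logarithm as fundamental solution, in conformal polar coordinates -/

lemma laplacian_eq_fderiv (ψ : ℂ → ℝ) (z : ℂ) :
    Laplacian.laplacian ψ z = fderiv ℝ (fderiv ℝ ψ) z 1 1 +
      fderiv ℝ (fderiv ℝ ψ) z Complex.I Complex.I := by
  rw [InnerProductSpace.laplacian_eq_iteratedFDeriv_complexPlane]
  simp [iteratedFDeriv_two_apply]

/-- Conformal invariance of the trace: `v` and `i v` form a scaled orthogonal frame. The mixed terms
cancel without symmetry of `B`. -/
lemma bilinear_apply_add_apply_I_mul (B : ℂ →L[ℝ] ℂ →L[ℝ] ℝ) (v : ℂ) :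
    B v v + B (Complex.I * v) (Complex.I * v) =
      Complex.normSq v * (B 1 1 + B Complex.I Complex.I) := by
  have e1 : v = v.re • (1 : ℂ) + v.im • Complex.I := by
    simp
  have e2 : Complex.I * v = (-v.im) • (1 : ℂ) + v.re • Complex.I := by
    apply Complex.ext <;> simp
  rw [e2]
  nth_rewrite 1 2 [e1]
  simp only [map_add, map_smul, add_apply, smul_apply,
    smul_eq_mul, Complex.normSq_apply]
  ring

/-- The point with polar coordinates `(r, θ)`. -/
noncomputable def polarPoint (p : ℝ × ℝ) : ℂ := p.1 * Complex.exp (p.2 * Complex.I)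

lemma continuous_polarPoint : Continuous polarPoint := by unfold polarPoint; fun_prop

lemma norm_polarPoint (p : ℝ × ℝ) : ‖polarPoint p‖ = |p.1| := by
  rw [polarPoint, norm_mul, Complex.norm_exp_ofReal_mul_I, Complex.norm_real, mul_one,
    Real.norm_eq_abs]

lemma hasDerivAt_polarPoint_fst (r θ : ℝ) :
    HasDerivAt (fun r : ℝ => polarPoint (r, θ)) (Complex.exp (θ * Complex.I)) r := by
  simpa [polarPoint] using (Complex.ofRealCLM.hasDerivAt (x := r)).mul_const
    (Complex.exp (θ * Complex.I))

lemma hasDerivAt_polarPoint_snd (r θ : ℝ) :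
    HasDerivAt (fun θ : ℝ => polarPoint (r, θ)) (Complex.I * polarPoint (r, θ)) θ := by
  have h0 : HasDerivAt (fun t : ℝ => (r : ℂ) * Complex.exp (t * Complex.I))
      (r * (Complex.exp (θ * Complex.I) * (1 * Complex.I))) θ :=
    (((Complex.ofRealCLM.hasDerivAt (x := θ)).mul_const Complex.I).cexp).const_mul (r : ℂ)
  refine h0.congr_deriv ?_
  simp only [polarPoint]
  ring

section Polar

variable {f : ℂ → ℂ} {ψ : ℂ → ℝ}

lemma hasDerivAt_fderiv_comp_apply (hf : DifferentiableOn ℂ f (Metric.ball 0 1))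
    (hψ : ContDiff ℝ 2 ψ) {c : ℝ → ℂ} {c' : ℂ} {t : ℝ} (hc : HasDerivAt c c' t)
    (hct : c t ∈ Metric.ball (0 : ℂ) 1) {W : ℂ → ℂ} {W' : ℂ} (hW : HasDerivAt W W' (c t)) :
    HasDerivAt (fun t => fderiv ℝ ψ (f (c t)) (W (c t)))
      (fderiv ℝ (fderiv ℝ ψ) (f (c t)) (c' * deriv f (c t)) (W (c t)) +
        fderiv ℝ ψ (f (c t)) (c' * W')) t := by
  have h1 : HasDerivAt (fun t => f (c t)) (deriv f (c t) * c') t :=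
    ((hf.differentiableAt (Metric.isOpen_ball.mem_nhds hct)).hasDerivAt).comp t hc
  have h2 : HasDerivAt (fun t => W (c t)) (W' * c') t := hW.comp t hc
  have h3 : DifferentiableAt ℝ (fderiv ℝ ψ) (f (c t)) :=
    ((hψ.fderiv_right (m := 1) (by norm_num)).differentiable (by norm_num)).differentiableAt
  have h4 := h3.hasFDerivAt.comp_hasDerivAt t h1
  rw [mul_comm c', mul_comm c']
  exact h4.clm_apply h2

lemma hasDerivAt_comp_real (hf : DifferentiableOn ℂ f (Metric.ball 0 1))
    (hψ : ContDiff ℝ 2 ψ) {c : ℝ → ℂ} {c' : ℂ} {t : ℝ} (hc : HasDerivAt c c' t)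
    (hct : c t ∈ Metric.ball (0 : ℂ) 1) :
    HasDerivAt (fun t => ψ (f (c t))) (fderiv ℝ ψ (f (c t)) (c' * deriv f (c t))) t := by
  have h1 : HasDerivAt (fun t => f (c t)) (deriv f (c t) * c') t :=
    ((hf.differentiableAt (Metric.isOpen_ball.mem_nhds hct)).hasDerivAt).comp t hc
  have h3 : DifferentiableAt ℝ ψ (f (c t)) :=
    (hψ.differentiable (by norm_num)).differentiableAt
  rw [mul_comm c']
  exact h3.hasFDerivAt.comp_hasDerivAt t h1

/-- The radial derivative of `r ∂ᵣ (ψ ∘ f)`. -/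
noncomputable def radialTerm (f : ℂ → ℂ) (ψ : ℂ → ℝ) (p : ℝ × ℝ) : ℝ :=
  fderiv ℝ (fderiv ℝ ψ) (f (polarPoint p))
      (Complex.exp (p.2 * Complex.I) * deriv f (polarPoint p))
      (polarPoint p * deriv f (polarPoint p)) +
    fderiv ℝ ψ (f (polarPoint p)) (Complex.exp (p.2 * Complex.I) *
      (deriv f (polarPoint p) + polarPoint p * deriv (deriv f) (polarPoint p)))

/-- The second angular derivative of `ψ ∘ f`, divided by the radius. -/
noncomputable def angularTerm (f : ℂ → ℂ) (ψ : ℂ → ℝ) (p : ℝ × ℝ) : ℝ :=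
  fderiv ℝ (fderiv ℝ ψ) (f (polarPoint p))
      (Complex.I * (Complex.exp (p.2 * Complex.I) * deriv f (polarPoint p)))
      (Complex.I * (polarPoint p * deriv f (polarPoint p))) -
    fderiv ℝ ψ (f (polarPoint p)) (Complex.exp (p.2 * Complex.I) *
      (deriv f (polarPoint p) + polarPoint p * deriv (deriv f) (polarPoint p)))

/-- This is `∂ᵣ(r ∂ᵣu) + (1/r) ∂²_θ u = r Δu` for `u = ψ ∘ f`: the first-order terms cancel and the
second-order ones yield `|f'|² Δψ`. -/
lemma radialTerm_add_angularTerm (p : ℝ × ℝ) :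
    radialTerm f ψ p + angularTerm f ψ p = p.1 * (Complex.normSq (deriv f (polarPoint p)) *
      Laplacian.laplacian ψ (f (polarPoint p))) := by
  set B := fderiv ℝ (fderiv ℝ ψ) (f (polarPoint p)) with hB
  set v := Complex.exp (p.2 * Complex.I) * deriv f (polarPoint p) with hv
  have e1 : polarPoint p * deriv f (polarPoint p) = p.1 • v := by
    rw [polarPoint, hv, Complex.real_smul, polarPoint]; ring
  have e2 : Complex.I * (p.1 • v) = p.1 • (Complex.I * v) := by
    rw [Complex.real_smul, Complex.real_smul]; ring
  have e3 : Complex.normSq v = Complex.normSq (deriv f (polarPoint p)) := by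
    rw [hv, map_mul, Complex.normSq_eq_norm_sq (Complex.exp _), Complex.norm_exp_ofReal_mul_I]
    simp
  have h := bilinear_apply_add_apply_I_mul B v
  rw [radialTerm, angularTerm, ← hB, ← hv, e1, e2, laplacian_eq_fderiv, ← hB, ← e3, ← h, map_smul,
    map_smul, smul_eq_mul, smul_eq_mul]
  ring

lemma deriv_differentiableOn (hf : DifferentiableOn ℂ f (Metric.ball 0 1)) :
    DifferentiableOn ℂ (deriv f) (Metric.ball 0 1) := hf.deriv Metric.isOpen_ball

lemma hasDerivAt_mul_deriv (hf : DifferentiableOn ℂ f (Metric.ball 0 1)) {z : ℂ}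
    (hz : z ∈ Metric.ball (0 : ℂ) 1) :
    HasDerivAt (fun z => z * deriv f z) (deriv f z + z * deriv (deriv f) z) z := by
  have := (hasDerivAt_id' z).fun_mul (((deriv_differentiableOn hf).differentiableAt
    (Metric.isOpen_ball.mem_nhds hz)).hasDerivAt)
  rwa [one_mul] at this

lemma polarPoint_mem {r : ℝ} (hr : |r| < 1) (θ : ℝ) :
    polarPoint (r, θ) ∈ Metric.ball (0 : ℂ) 1 := by
  rwa [mem_ball_zero_iff, norm_polarPoint]

lemma hasDerivAt_radial (hf : DifferentiableOn ℂ f (Metric.ball 0 1))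
    (hψ : ContDiff ℝ 2 ψ) {r : ℝ} (hr : |r| < 1) (θ : ℝ) :
    HasDerivAt (fun r => fderiv ℝ ψ (f (polarPoint (r, θ)))
      (polarPoint (r, θ) * deriv f (polarPoint (r, θ)))) (radialTerm f ψ (r, θ)) r :=
  hasDerivAt_fderiv_comp_apply hf hψ (hasDerivAt_polarPoint_fst r θ) (polarPoint_mem hr θ)
    (hasDerivAt_mul_deriv hf (polarPoint_mem hr θ))

lemma hasDerivAt_angular (hf : DifferentiableOn ℂ f (Metric.ball 0 1))
    (hψ : ContDiff ℝ 2 ψ) {r : ℝ} (hr : |r| < 1) (θ : ℝ) :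
    HasDerivAt (fun θ => fderiv ℝ ψ (f (polarPoint (r, θ)))
      (Complex.I * (polarPoint (r, θ) * deriv f (polarPoint (r, θ)))))
      (r * angularTerm f ψ (r, θ)) θ := by
  have := hasDerivAt_fderiv_comp_apply hf hψ (hasDerivAt_polarPoint_snd r θ) (polarPoint_mem hr θ)
    ((hasDerivAt_mul_deriv hf (polarPoint_mem hr θ)).const_mul Complex.I)
  refine this.congr_deriv ?_
  have e : polarPoint (r, θ) = r * Complex.exp (θ * Complex.I) := rfl
  set z := polarPoint (r, θ)
  have e1 : Complex.I * z * deriv f z =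
      r • (Complex.I * (Complex.exp (θ * Complex.I) * deriv f z)) := by
    rw [Complex.real_smul]; linear_combination Complex.I * deriv f z * e
  have e2 : Complex.I * z * (Complex.I * (deriv f z + z * deriv (deriv f) z)) =
      (-r) • (Complex.exp (θ * Complex.I) * (deriv f z + z * deriv (deriv f) z)) := by
    rw [Complex.real_smul]
    push_cast
    linear_combination z * (deriv f z + z * deriv (deriv f) z) * Complex.I_sq -
      (deriv f z + z * deriv (deriv f) z) * e
  rw [angularTerm, e1, e2, map_smul, map_smul, smul_apply, smul_eq_mul,
    smul_eq_mul]
  ring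

lemma continuousOn_terms (hf : DifferentiableOn ℂ f (Metric.ball 0 1)) (hψ : ContDiff ℝ 2 ψ) :
    ContinuousOn (radialTerm f ψ) {p | |p.1| < 1} ∧
      ContinuousOn (angularTerm f ψ) {p | |p.1| < 1} := by
  have hmaps : MapsTo polarPoint {p : ℝ × ℝ | |p.1| < 1} (Metric.ball 0 1) :=
    fun p hp => polarPoint_mem hp p.2
  have hpc : ContinuousOn polarPoint {p : ℝ × ℝ | |p.1| < 1} := continuous_polarPoint.continuousOn
  have h0 := hf.continuousOn.comp hpc hmaps
  have h1 := (deriv_differentiableOn hf).continuousOn.comp hpc hmaps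
  have h2 := (deriv_differentiableOn (deriv_differentiableOn hf)).continuousOn.comp hpc hmaps
  have hψ1 := hψ.fderiv_right (m := 1) (by norm_num)
  have h3 := hψ1.continuous.comp_continuousOn h0
  have h4 := (hψ1.fderiv_right (m := 0) (by norm_num)).continuous.comp_continuousOn h0
  have h5 : ContinuousOn (fun p : ℝ × ℝ => Complex.exp (p.2 * Complex.I)) {p | |p.1| < 1} := by
    fun_prop
  have h6 := h3.clm_apply (h5.mul (h1.add (hpc.mul h2)))
  exact ⟨((h4.clm_apply (h5.mul h1)).clm_apply (hpc.mul h1)).add h6,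
    ((h4.clm_apply (continuousOn_const.mul (h5.mul h1))).clm_apply
      (continuousOn_const.mul (hpc.mul h1))).sub h6⟩

lemma terms_eq_zero {p : ℝ × ℝ} (hp : f (polarPoint p) ∉ tsupport ψ) :
    radialTerm f ψ p = 0 ∧ angularTerm f ψ p = 0 := by
  have h1 : fderiv ℝ ψ (f (polarPoint p)) = 0 :=
    image_eq_zero_of_notMem_tsupport fun h => hp (tsupport_fderiv_subset ℝ h)
  have h2 : fderiv ℝ (fderiv ℝ ψ) (f (polarPoint p)) = 0 :=
    image_eq_zero_of_notMem_tsupport fun h =>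
      hp (tsupport_fderiv_subset ℝ (tsupport_fderiv_subset ℝ h))
  simp [radialTerm, angularTerm, h1, h2]

lemma exists_bound_of_continuousOn_polar {G : ℝ × ℝ → ℝ} (hG : ContinuousOn G {p | |p.1| < 1})
    {ρ : ℝ} (hρ1 : ρ < 1) (hG0 : ∀ p : ℝ × ℝ, ρ < |p.1| → |p.1| < 1 → G p = 0) :
    ∃ M : ℝ, ∀ p ∈ Ioo (0 : ℝ) 1 ×ˢ Icc (-Real.pi) Real.pi, ‖G p‖ ≤ M := by
  have hK : IsCompact (Icc (0 : ℝ) ρ ×ˢ Icc (-Real.pi) Real.pi) := isCompact_Icc.prod isCompact_Icc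
  obtain ⟨M, hM⟩ := hK.exists_bound_of_continuousOn (hG.mono fun p hp => by
    rw [mem_ofPred_eq, abs_of_nonneg hp.1.1]; exact hp.1.2.trans_lt hρ1)
  refine ⟨max M 0, fun p hp => ?_⟩
  rcases le_or_gt p.1 ρ with h | h
  · exact (hM p ⟨⟨hp.1.1.le, h⟩, hp.2⟩).trans (le_max_left _ _)
  · rw [hG0 p (by rwa [abs_of_pos hp.1.1]) (by rw [abs_of_pos hp.1.1]; exact hp.1.2), norm_zero]
    exact le_max_right _ _

/-- Vanishing near the unit circle makes `G` bounded, so only the integrable singularity of `log r`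
at the origin remains. This justifies Fubini. -/
lemma integrableOn_log_mul {G : ℝ × ℝ → ℝ} (hG : ContinuousOn G {p | |p.1| < 1})
    {ρ : ℝ} (hρ1 : ρ < 1) (hG0 : ∀ p : ℝ × ℝ, ρ < |p.1| → |p.1| < 1 → G p = 0) :
    IntegrableOn (fun p : ℝ × ℝ => G p * Real.log p.1)
      (Ioo (0 : ℝ) 1 ×ˢ Ioo (-Real.pi) Real.pi) (volume.prod volume) := by
  obtain ⟨M, hM⟩ := exists_bound_of_continuousOn_polar hG hρ1 hG0
  have hms : MeasurableSet (Ioo (0 : ℝ) 1 ×ˢ Ioo (-Real.pi) Real.pi) :=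
    measurableSet_Ioo.prod measurableSet_Ioo
  have hlog : IntegrableOn (fun p : ℝ × ℝ => Real.log p.1)
      (Ioo (0 : ℝ) 1 ×ˢ Ioo (-Real.pi) Real.pi) (volume.prod volume) := by
    have h1 : IntegrableOn Real.log (Ioo 0 1) volume :=
      ((intervalIntegrable_iff_integrableOn_Ioo_of_le zero_le_one).mp
        intervalIntegral.intervalIntegrable_log')
    rw [IntegrableOn, ← Measure.prod_restrict]
    exact h1.comp_fst _
  refine hlog.bdd_mul (c := M) ((hG.mono fun p hp => ?_).aestronglyMeasurable hms) ?_
  · rw [mem_ofPred_eq, abs_of_pos hp.1.1]; exact hp.1.2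
  · filter_upwards [ae_restrict_mem hms] with p hp
    exact hM p ⟨hp.1, Ioo_subset_Icc_self hp.2⟩

end Polar

section Polar

variable {f : ℂ → ℂ} {ψ : ℂ → ℝ}

/-- With `P = r ∂ᵣ(ψ ∘ f)`, the integrand `P' log r` has the primitive `P log r - ψ ∘ f`. It tends
to `-ψ(f 0)` at `0`, because `P = O(r)`, and it vanishes near `r = 1`. -/
lemma integral_radialTerm_mul_log (hf : DifferentiableOn ℂ f (Metric.ball 0 1))
    (hψ : ContDiff ℝ 2 ψ) {ρ : ℝ} (hρ1 : ρ < 1)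
    (hsupp : ∀ z : ℂ, ρ < ‖z‖ → ‖z‖ < 1 → f z ∉ tsupport ψ) (θ : ℝ) :
    ∫ r in Ioo (0 : ℝ) 1, radialTerm f ψ (r, θ) * Real.log r = ψ (f 0) := by
  have habs : ∀ r ∈ Ioo (0 : ℝ) 1, |r| < 1 := fun r hr => by rw [abs_of_pos hr.1]; exact hr.2
  set P : ℝ → ℝ := fun r => fderiv ℝ ψ (f (polarPoint (r, θ)))
    (polarPoint (r, θ) * deriv f (polarPoint (r, θ))) with hP
  have hpp : Continuous fun r : ℝ => polarPoint (r, θ) :=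
    continuous_polarPoint.comp (continuous_id.prodMk continuous_const)
  have hcont : ContinuousOn (fun r => radialTerm f ψ (r, θ)) (Icc 0 (max ρ 0)) :=
    (continuousOn_terms hf hψ).1.comp (by fun_prop) fun r hr => by
      rw [mem_ofPred_eq, abs_of_nonneg hr.1]
      exact hr.2.trans_lt (max_lt hρ1 one_pos)
  have hint : IntervalIntegrable (fun r => radialTerm f ψ (r, θ) * Real.log r) volume 0 1 := by
    have h1 : IntervalIntegrable (fun r => radialTerm f ψ (r, θ) * Real.log r) volume 0
        (max ρ 0) := by
      refine intervalIntegral.intervalIntegrable_log'.continuousOn_mul ?_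
      rwa [uIcc_of_le (le_max_right _ _)]
    have h2 : IntervalIntegrable (fun r => radialTerm f ψ (r, θ) * Real.log r) volume
        (max ρ 0) 1 := by
      rw [intervalIntegrable_iff_integrableOn_Ioo_of_le (max_le hρ1.le zero_le_one)]
      refine (integrableOn_zero (ε' := ℝ)).congr_fun (fun r hr => ?_) measurableSet_Ioo
      have hr0 : 0 < r := (le_max_right _ _).trans_lt hr.1
      rw [(terms_eq_zero (hsupp _ _ _)).1, zero_mul]
      · rw [norm_polarPoint, abs_of_pos hr0]; exact (le_max_left _ _).trans_lt hr.1
      · rw [norm_polarPoint, abs_of_pos hr0]; exact hr.2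
    exact h1.trans h2
  have hderiv : ∀ r ∈ Ioo (0 : ℝ) 1,
      HasDerivAt (fun r => P r * Real.log r - ψ (f (polarPoint (r, θ))))
        (radialTerm f ψ (r, θ) * Real.log r) r := by
    intro r hr
    have h1 := (hasDerivAt_radial hf hψ (habs r hr) θ).fun_mul (Real.hasDerivAt_log hr.1.ne')
    have h2 := hasDerivAt_comp_real hf hψ (hasDerivAt_polarPoint_fst r θ)
      (polarPoint_mem (habs r hr) θ)
    refine (h1.fun_sub h2).congr_deriv ?_
    have e : polarPoint (r, θ) * deriv f (polarPoint (r, θ)) =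
        r • (Complex.exp (θ * Complex.I) * deriv f (polarPoint (r, θ))) := by
      rw [Complex.real_smul]
      nth_rewrite 1 [polarPoint]
      ring
    rw [e, map_smul, smul_eq_mul]
    have := hr.1.ne'
    field_simp
    ring
  have h0ball : (0 : ℂ) ∈ Metric.ball (0 : ℂ) 1 := Metric.mem_ball_self one_pos
  have hpp0 : polarPoint (0, θ) = 0 := by simp [polarPoint]
  have hf0 : ContinuousAt (fun r : ℝ => f (polarPoint (r, θ))) 0 := by
    refine ContinuousAt.comp (g := f) ?_ hpp.continuousAt
    rw [hpp0]
    exact (hf.differentiableAt (Metric.isOpen_ball.mem_nhds h0ball)).continuousAt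
  have hlim0 : Tendsto (fun r => P r * Real.log r - ψ (f (polarPoint (r, θ)))) (𝓝[>] 0)
      (𝓝 (0 - ψ (f 0))) := by
    have hF0 : ContinuousAt (fun r : ℝ => deriv f (polarPoint (r, θ))) 0 := by
      refine ContinuousAt.comp (g := deriv f) ?_ hpp.continuousAt
      rw [hpp0]
      exact ((deriv_differentiableOn hf).differentiableAt
        (Metric.isOpen_ball.mem_nhds h0ball)).continuousAt
    have hL0 : ContinuousAt (fun r : ℝ => fderiv ℝ ψ (f (polarPoint (r, θ)))) 0 :=
      ContinuousAt.comp (g := fderiv ℝ ψ)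
        (hψ.fderiv_right (m := 1) (by norm_num)).continuous.continuousAt hf0
    have hG : ContinuousAt (fun r : ℝ => fderiv ℝ ψ (f (polarPoint (r, θ)))
        (Complex.exp (θ * Complex.I) * deriv f (polarPoint (r, θ))) * (r * Real.log r)) 0 :=
      (hL0.clm_apply (continuousAt_const.mul hF0)).mul Real.continuous_mul_log.continuousAt
    have hGt := hG.tendsto.sub ((hψ.continuous.continuousAt).comp hf0).tendsto
    simp only [Real.log_zero, mul_zero, Function.comp_apply, hpp0] at hGt
    refine (tendsto_nhdsWithin_of_tendsto_nhds hGt).congr fun r => ?_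
    have e : polarPoint (r, θ) * deriv f (polarPoint (r, θ)) =
        r • (Complex.exp (θ * Complex.I) * deriv f (polarPoint (r, θ))) := by
      rw [Complex.real_smul]
      nth_rewrite 1 [polarPoint]
      ring
    simp only [hP]
    rw [e, map_smul, smul_eq_mul]
    ring
  have hlim1 : Tendsto (fun r => P r * Real.log r - ψ (f (polarPoint (r, θ)))) (𝓝[<] 1)
      (𝓝 0) := by
    refine tendsto_const_nhds.congr' ?_
    have h1 : ∀ᶠ r : ℝ in 𝓝[<] 1, max ρ 0 < r :=
      nhdsWithin_le_nhds (lt_mem_nhds (max_lt hρ1 one_pos))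
    filter_upwards [h1, self_mem_nhdsWithin] with r hr hr1
    have hr0 : 0 < r := (le_max_right _ _).trans_lt hr
    have hn : f (polarPoint (r, θ)) ∉ tsupport ψ := by
      refine hsupp _ ?_ ?_ <;> rw [norm_polarPoint, abs_of_pos hr0]
      · exact (le_max_left _ _).trans_lt hr
      · exact hr1
    have h2 : fderiv ℝ ψ (f (polarPoint (r, θ))) = 0 :=
      image_eq_zero_of_notMem_tsupport fun h => hn (tsupport_fderiv_subset ℝ h)
    simp [hP, h2, image_eq_zero_of_notMem_tsupport hn]
  have := intervalIntegral.integral_eq_sub_of_hasDerivAt_of_tendsto one_pos hderiv hint hlim0 hlim1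
  rw [intervalIntegral.integral_of_le zero_le_one, integral_Ioc_eq_integral_Ioo] at this
  rw [this]
  ring

/-- Up to the factor `r`, the integrand is the angular derivative of a `2π`-periodic function. -/
lemma integral_angularTerm (hf : DifferentiableOn ℂ f (Metric.ball 0 1))
    (hψ : ContDiff ℝ 2 ψ) {r : ℝ} (hr : r ∈ Ioo (0 : ℝ) 1) :
    ∫ θ in Ioo (-Real.pi) Real.pi, angularTerm f ψ (r, θ) = 0 := by
  have habs : |r| < 1 := by rw [abs_of_pos hr.1]; exact hr.2
  have hc : Continuous fun θ => angularTerm f ψ (r, θ) :=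
    (continuousOn_terms hf hψ).2.comp_continuous (by fun_prop) fun θ => habs
  have h1 := intervalIntegral.integral_eq_sub_of_hasDerivAt
    (a := -Real.pi) (b := Real.pi) (fun θ _ => hasDerivAt_angular hf hψ habs θ)
    ((hc.const_mul r).intervalIntegrable _ _)
  have h2 : polarPoint (r, Real.pi) = polarPoint (r, -Real.pi) := by
    simp [polarPoint, Complex.exp_neg]
  rw [h2, sub_self, intervalIntegral.integral_const_mul, intervalIntegral.integral_of_le
    (by linarith [Real.pi_pos]), integral_Ioc_eq_integral_Ioo] at h1
  exact (mul_eq_zero.mp h1).resolve_left hr.1.ne'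

/-- The logarithm is the fundamental solution of the Laplacian, in conformal polar coordinates. -/
theorem integral_log_mul_laplacian_polar (hf : DifferentiableOn ℂ f (Metric.ball 0 1))
    (hψ : ContDiff ℝ 2 ψ) {ρ : ℝ} (hρ1 : ρ < 1)
    (hsupp : ∀ z : ℂ, ρ < ‖z‖ → ‖z‖ < 1 → f z ∉ tsupport ψ) :
    ∫ p in Ioo (0 : ℝ) 1 ×ˢ Ioo (-Real.pi) Real.pi, p.1 * (Real.log p.1 *
      (Complex.normSq (deriv f (polarPoint p)) * Laplacian.laplacian ψ (f (polarPoint p)))) =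
      2 * Real.pi * ψ (f 0) := by
  have hz : ∀ p : ℝ × ℝ, ρ < |p.1| → |p.1| < 1 → f (polarPoint p) ∉ tsupport ψ := fun p h1 h2 =>
    hsupp _ (by rwa [norm_polarPoint]) (by rwa [norm_polarPoint])
  have hi1 := integrableOn_log_mul (continuousOn_terms hf hψ).1 hρ1
    fun p h1 h2 => (terms_eq_zero (hz p h1 h2)).1
  have hi2 := integrableOn_log_mul (continuousOn_terms hf hψ).2 hρ1
    fun p h1 h2 => (terms_eq_zero (hz p h1 h2)).2
  have e : ∀ p : ℝ × ℝ, p.1 * (Real.log p.1 *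
      (Complex.normSq (deriv f (polarPoint p)) * Laplacian.laplacian ψ (f (polarPoint p)))) =
      radialTerm f ψ p * Real.log p.1 + angularTerm f ψ p * Real.log p.1 := fun p => by
    rw [← add_mul, radialTerm_add_angularTerm]; ring
  simp_rw [e]
  rw [Measure.volume_eq_prod, integral_add hi1 hi2]
  -- The radial term is integrated in `r` first and the angular term in `θ` first, so each inner
  -- integral is an exact derivative.
  have e1 : ∫ p in Ioo (0 : ℝ) 1 ×ˢ Ioo (-Real.pi) Real.pi, radialTerm f ψ p * Real.log p.1
      ∂(volume.prod volume) = 2 * Real.pi * ψ (f 0) := by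
    rw [IntegrableOn, ← Measure.prod_restrict] at hi1
    rw [← Measure.prod_restrict, integral_prod_symm _ hi1]
    simp only
    simp_rw [integral_radialTerm_mul_log hf hψ hρ1 hsupp]
    rw [setIntegral_const, smul_eq_mul, Real.volume_real_Ioo_of_le (by linarith [Real.pi_pos])]
    ring
  have e2 : ∫ p in Ioo (0 : ℝ) 1 ×ˢ Ioo (-Real.pi) Real.pi, angularTerm f ψ p * Real.log p.1
      ∂(volume.prod volume) = 0 := by
    rw [setIntegral_prod _ hi2]
    refine setIntegral_eq_zero_of_forall_eq_zero fun r hr => ?_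
    simp only
    rw [integral_mul_const, integral_angularTerm hf hψ hr, zero_mul]
  rw [e1, e2, add_zero]

end Polar

/-! ### The Green's function of the image and its normal derivative -/

lemma integrableOn_log_norm_ball :
    IntegrableOn (fun z : ℂ => Real.log ‖z‖) (Metric.ball 0 1) := by
  have h1 : Integrable (fun z : ℂ => (Iio (1 : ℝ)).indicator Real.log ‖z‖) := by
    rw [integrable_fun_norm_addHaar]
    have h2 : IntegrableOn (fun y : ℝ => y * Real.log y) (Iio 1 ∩ Ioi 0) := by
      refine (Real.continuous_mul_log.integrableOn_Icc (a := 0) (b := 1)).mono_set ?_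
      exact fun y hy => ⟨(mem_Ioi.mp hy.2).le, (mem_Iio.mp hy.1).le⟩
    have h3 := (integrable_indicator_iff (μ := volume.restrict (Ioi 0)) measurableSet_Iio
      (f := fun y : ℝ => y * Real.log y)).mpr (by
        rwa [IntegrableOn, Measure.restrict_restrict measurableSet_Iio])
    refine h3.congr (Eventually.of_forall fun y => ?_)
    simp only [Complex.finrank_real_complex, Nat.reduceSub, pow_one, smul_eq_mul, indicator]
    split_ifs <;> simp
  refine h1.integrableOn.congr_fun (fun z hz => ?_) measurableSet_ball
  exact indicator_of_mem (mem_Iio.mpr (mem_ball_zero_iff.mp hz)) _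

lemma integral_ball_eq_integral_polarPoint (G : ℂ → ℝ) :
    ∫ z in Metric.ball (0 : ℂ) 1, G z =
      ∫ p in Ioo (0 : ℝ) 1 ×ˢ Ioo (-Real.pi) Real.pi, p.1 * G (polarPoint p) := by
  have hpp : ∀ p : ℝ × ℝ, Complex.polarCoord.symm p = polarPoint p := fun p => by
    rw [Complex.polarCoord_symm_apply, polarPoint, Complex.exp_mul_I, Complex.ofReal_cos,
      Complex.ofReal_sin]
  rw [← integral_indicator measurableSet_ball, ← Complex.integral_comp_polarCoord_symm]
  have hsub : Ioo (0 : ℝ) 1 ×ˢ Ioo (-Real.pi) Real.pi ⊆ polarCoord.target :=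
    prod_mono Ioo_subset_Ioi_self subset_rfl
  refine (setIntegral_eq_of_subset_of_forall_sdiff_eq_zero polarCoord.open_target.measurableSet
    hsub ?_).trans ?_
  · rintro p ⟨hp, hp'⟩
    rw [hpp, indicator_of_notMem, smul_zero]
    rw [mem_ball_zero_iff, norm_polarPoint, abs_of_pos hp.1]
    exact fun h => hp' ⟨⟨hp.1, h⟩, hp.2⟩
  · refine setIntegral_congr_fun (measurableSet_Ioo.prod measurableSet_Ioo) fun p hp => ?_
    rw [hpp, indicator_of_mem, smul_eq_mul]
    rw [mem_ball_zero_iff, norm_polarPoint, abs_of_pos hp.1.1]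
    exact hp.1.2

/-- The real determinant of a complex-linear map is the norm of its complex determinant; this gives
the Jacobian `|f'|²`. -/
lemma det_restrictScalars_toSpanSingleton (a : ℂ) :
    ((ContinuousLinearMap.toSpanSingleton ℂ a).restrictScalars ℝ : ℂ →L[ℝ] ℂ).det =
      Complex.normSq a := by
  have h : ((ContinuousLinearMap.toSpanSingleton ℂ a).restrictScalars ℝ : ℂ →L[ℝ] ℂ).det =
      LinearMap.det (((ContinuousLinearMap.toSpanSingleton ℂ a : ℂ →L[ℂ] ℂ) :
        ℂ →ₗ[ℂ] ℂ).restrictScalars ℝ) := rfl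
  have h2 : LinearMap.det ((ContinuousLinearMap.toSpanSingleton ℂ a : ℂ →L[ℂ] ℂ) :
        ℂ →ₗ[ℂ] ℂ) = a := ContinuousLinearMap.det_toSpanSingleton a
  rw [h, LinearMap.det_restrictScalars, h2, Algebra.norm_complex_apply]

namespace IsDiskChart

variable {α : ℝ} {f : ℂ → ℂ} {A : ℂ → ℂ → ℂ}

/-- The Green's function of `f '' ball 0 1` with pole `f 0`. -/
noncomputable def green (f : ℂ → ℂ) (ζ : ℂ) : ℝ := -(1 / (2 * Real.pi)) * Real.log ‖inv f ζ‖

lemma hasFDerivWithinAt_real (H : IsDiskChart α f A) :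
    ∀ z ∈ Metric.ball (0 : ℂ) 1, HasFDerivWithinAt f
      ((ContinuousLinearMap.toSpanSingleton ℂ (deriv f z)).restrictScalars ℝ : ℂ →L[ℝ] ℂ)
      (Metric.ball 0 1) z := fun z hz => by
  have h := (H.hasDerivAt hz).differentiableAt.hasDerivAt
  exact (h.hasFDerivAt.restrictScalars ℝ).hasFDerivWithinAt

lemma continuousOn_green (H : IsDiskChart α f A) :
    ContinuousOn (green f) (closure (f '' Metric.ball 0 1) \ {f 0}) := by
  rw [H.closure_image]
  refine continuousOn_const.mul (ContinuousOn.log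
    ((H.continuousOn_inv.mono sdiff_subset).norm) ?_)
  rintro _ ⟨⟨z, hz, rfl⟩, hne⟩
  rw [H.inv_apply hz, norm_ne_zero_iff]
  rintro rfl
  exact hne rfl

lemma integrableOn_green (H : IsDiskChart α f A) :
    IntegrableOn (green f) (f '' Metric.ball 0 1) := by
  obtain ⟨M, hM0, hM⟩ := H.exists_norm_slope_le
  rw [integrableOn_image_iff_integrableOn_abs_det_fderiv_smul volume measurableSet_ball
    H.hasFDerivWithinAt_real (H.injOn.mono Metric.ball_subset_closedBall)]
  have h1 : IntegrableOn (fun z : ℂ => (-(1 / (2 * Real.pi)) * ‖deriv f z‖ ^ 2) * Real.log ‖z‖)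
      (Metric.ball 0 1) := by
    refine Integrable.bdd_mul integrableOn_log_norm_ball (c := 1 / (2 * Real.pi) * M ^ 2) ?_ ?_
    · refine ContinuousOn.aestronglyMeasurable ?_ measurableSet_ball
      exact continuousOn_const.mul
        ((deriv_differentiableOn H.differentiableOn).continuousOn.norm.pow 2)
    · filter_upwards [ae_restrict_mem measurableSet_ball] with z hz
      have hz' := Metric.ball_subset_closedBall hz
      rw [(H.hasDerivAt hz).deriv, norm_mul, norm_neg, norm_pow, norm_norm, Real.norm_eq_abs,
        abs_of_pos (by have := Real.pi_pos; positivity)]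
      have := hM z hz' z hz'
      have := Real.pi_pos
      gcongr
  refine h1.congr_fun (fun z hz => ?_) measurableSet_ball
  simp only
  rw [det_restrictScalars_toSpanSingleton, green, H.inv_apply (Metric.ball_subset_closedBall hz),
    smul_eq_mul, abs_of_nonneg (Complex.normSq_nonneg _), Complex.normSq_eq_norm_sq]
  ring

/-- The substitution `ζ = f z` brings in the Jacobian `|f'|²`, exactly the factor in `Δ(ψ ∘ f) =
|f'|² (Δψ) ∘ f`, and reduces the claim to the logarithm on the disk. -/
lemma integral_green_mul_laplacian (H : IsDiskChart α f A) {ψ : ℂ → ℝ} (hψ : ContDiff ℝ 2 ψ)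
    (hc : HasCompactSupport ψ) (hsupp : tsupport ψ ⊆ f '' Metric.ball 0 1) :
    ∫ ζ in f '' Metric.ball 0 1, green f ζ * Laplacian.laplacian ψ ζ = -ψ (f 0) := by
  have hpi := Real.pi_pos
  have hK : IsCompact (inv f '' tsupport ψ) := hc.isCompact.image_of_continuousOn
    (H.continuousOn_inv.mono (hsupp.trans (image_mono Metric.ball_subset_closedBall)))
  have hKsub : inv f '' tsupport ψ ⊆ Metric.ball 0 1 := by
    rintro _ ⟨ζ, hζ, rfl⟩
    obtain ⟨z, hz, rfl⟩ := hsupp hζ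
    rwa [H.inv_apply (Metric.ball_subset_closedBall hz)]
  obtain ⟨ρ, hρ, hρK⟩ := exists_pos_lt_subset_ball one_pos hK.isClosed hKsub
  have hz : ∀ z : ℂ, ρ < ‖z‖ → ‖z‖ < 1 → f z ∉ tsupport ψ := by
    intro z h1 h2 hmem
    have h3 := hρK (mem_image_of_mem (inv f) hmem)
    rw [H.inv_apply (mem_closedBall_zero_iff.mpr h2.le), mem_ball_zero_iff] at h3
    exact lt_asymm h1 h3
  have hpolar := integral_log_mul_laplacian_polar H.differentiableOn hψ hρ.2 hz
  rw [integral_image_eq_integral_abs_det_fderiv_smul volume measurableSet_ball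
    H.hasFDerivWithinAt_real (H.injOn.mono Metric.ball_subset_closedBall)]
  have e : ∀ z ∈ Metric.ball (0 : ℂ) 1,
      |((ContinuousLinearMap.toSpanSingleton ℂ (deriv f z)).restrictScalars ℝ : ℂ →L[ℝ] ℂ).det| •
        (green f (f z) * Laplacian.laplacian ψ (f z)) = -(1 / (2 * Real.pi)) *
        (Real.log ‖z‖ * (Complex.normSq (deriv f z) * Laplacian.laplacian ψ (f z))) := by
    intro z hz
    rw [det_restrictScalars_toSpanSingleton, green, H.inv_apply (Metric.ball_subset_closedBall hz),
      smul_eq_mul, abs_of_nonneg (Complex.normSq_nonneg _)]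
    ring
  rw [setIntegral_congr_fun measurableSet_ball e, integral_const_mul,
    integral_ball_eq_integral_polarPoint]
  have e2 : ∀ p ∈ Ioo (0 : ℝ) 1 ×ˢ Ioo (-Real.pi) Real.pi,
      p.1 * (Real.log ‖polarPoint p‖ * (Complex.normSq (deriv f (polarPoint p)) *
        Laplacian.laplacian ψ (f (polarPoint p)))) =
      p.1 * (Real.log p.1 * (Complex.normSq (deriv f (polarPoint p)) *
        Laplacian.laplacian ψ (f (polarPoint p)))) := fun p hp => by
    rw [norm_polarPoint, abs_of_pos hp.1.1]
  rw [setIntegral_congr_fun (measurableSet_Ioo.prod measurableSet_Ioo) e2, hpolar]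
  field_simp

theorem isGreenFunction (H : IsDiskChart α f A) :
    IsGreenFunction (f '' Metric.ball 0 1) (f 0) (green f) where
  continuousOn := H.continuousOn_green
  boundary := by
    rw [H.frontier_image]
    rintro _ ⟨z, hz, rfl⟩
    rw [green, H.inv_apply (Metric.sphere_subset_closedBall hz), mem_sphere_zero_iff_norm.mp hz,
      Real.log_one, mul_zero]
  locallyIntegrable := H.integrableOn_green.locallyIntegrableOn
  neg_laplacian_eq_dirac := fun ψ hψ hc hsupp => by
    rw [H.integral_green_mul_laplacian (contDiff_infty.mp hψ 2) hc hsupp, neg_neg]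

/-- For small positive times the inner normal at a boundary point stays in the domain. -/
lemma eventually_add_normal_mem (H : IsDiskChart α f A) (hα0 : 0 < α) (hα1 : α ≤ 1) {z : ℂ}
    (hz : ‖z‖ = 1) :
    ∀ᶠ t : ℝ in 𝓝[>] 0, f z + (t : ℂ) * (Complex.I * tangent A z) ∈ f '' Metric.ball 0 1 := by
  obtain ⟨δ, η, g, C, hδ, hη, -, hg0, -, -, hg⟩ := H.exists_epigraph hα0 hα1 hz
  have h1 : ∀ᶠ t : ℝ in 𝓝[>] 0, t < η := nhdsWithin_le_nhds (gt_mem_nhds hη)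
  filter_upwards [h1, self_mem_nhdsWithin] with t ht ht0
  have ht0' : 0 < t := ht0
  -- The inner normal is the axis `x = 0` of the epigraph coordinates.
  have := (hg 0 ⟨by linarith, hδ⟩ t ⟨by linarith, ht⟩).mpr (by rwa [hg0])
  rwa [Complex.ofReal_zero, zero_add, mul_assoc] at this

/-- The interior normal derivative of the Green's function at `f z` is `1 / (2π |f'(z)|)`. -/
theorem hasDerivWithinAt_green_normal (H : IsDiskChart α f A) (hα0 : 0 < α) (hα1 : α ≤ 1) {z : ℂ}
    (hz : ‖z‖ = 1) :
    HasDerivWithinAt (fun t : ℝ => green f (f z + (t : ℂ) * (Complex.I * tangent A z)))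
      (1 / (2 * Real.pi * ‖A z z‖)) (Ici 0) 0 := by
  have hz' : z ∈ Metric.closedBall (0 : ℂ) 1 := mem_closedBall_zero_iff.mpr hz.le
  have hA := H.slope_ne_zero hz' hz'
  have hAn : (‖A z z‖ : ℂ) ≠ 0 := by exact_mod_cast norm_ne_zero_iff.mpr hA
  set n := Complex.I * tangent A z with hn
  -- The inverse is only known to be differentiable within the closed image, so the derivative is
  -- taken within `S`, a one-sided neighbourhood of `0`.
  set S : Set ℝ := {t | f z + (t : ℂ) * n ∈ f '' Metric.closedBall 0 1} with hS
  have hSnhds : S ∈ 𝓝[Ici 0] (0 : ℝ) := by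
    rw [← Ioi_insert, nhdsWithin_insert]
    refine Filter.mem_sup.mpr ⟨?_, ?_⟩
    · rw [Filter.mem_pure, hS, mem_ofPred_eq, Complex.ofReal_zero, zero_mul, add_zero]
      exact mem_image_of_mem f hz'
    · exact (H.eventually_add_normal_mem hα0 hα1 hz).mono fun t ht =>
        image_mono Metric.ball_subset_closedBall ht
  have hline : HasDerivAt (fun t : ℝ => f z + (t : ℂ) * n) n 0 := by
    simpa using ((Complex.ofRealCLM.hasDerivAt (x := 0)).mul_const n).const_add (f z)
  have h0 : f z + ((0 : ℝ) : ℂ) * n = f z := by simp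
  have hinv : HasDerivWithinAt (fun t : ℝ => inv f (f z + (t : ℂ) * n)) (n * (A z z)⁻¹) S 0 := by
    have h1 := H.hasDerivWithinAt_inv hz'
    rw [← h0] at h1
    exact h1.scomp 0 hline.hasDerivWithinAt fun t ht => ht
  have hsq := hinv.norm_sq
  rw [h0, H.inv_apply hz'] at hsq
  have hinner : inner ℝ z (n * (A z z)⁻¹) = -‖A z z‖⁻¹ := by
    have e : n * (A z z)⁻¹ = ((-‖A z z‖⁻¹ : ℝ) : ℂ) * z := by
      rw [hn, tangent]
      push_cast
      field_simp
      linear_combination z * Complex.I_sq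
    rw [e, ← Complex.real_smul, inner_smul_right, real_inner_self_eq_norm_sq, hz]
    ring
  rw [hinner] at hsq
  have hlog := hsq.log (by rw [h0, H.inv_apply hz', hz]; norm_num)
  rw [h0, H.inv_apply hz', hz] at hlog
  -- The constant `1/(4π)` instead of `1/(2π)` comes from differentiating `log |f⁻¹|²`.
  have hfin := (hlog.const_mul (-(1 / (4 * Real.pi)))).mono_of_mem_nhdsWithin hSnhds
  refine (hfin.congr_deriv ?_).congr_of_eventuallyEq (Eventually.of_forall fun t => ?_) ?_
  · have := Real.pi_ne_zero
    have := norm_ne_zero_iff.mpr hA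
    field_simp
    norm_num
  all_goals
    simp only [green]
    rw [Real.log_pow]
    push_cast
    ring

end IsDiskChart

/-! ### The change of variable between arclength and angle -/

section Arclength

variable {φ : ℝ → ℝ} {L : ℝ}

lemma hasDerivAt_Phi (hφ : Continuous φ) (s : ℝ) :
    HasDerivAt (Phi φ) (2 * Real.pi * φ s) s :=
  (hφ.integral_hasStrictDerivAt 0 s).hasDerivAt.const_mul _

lemma strictMono_Phi (hφ : Continuous φ) (hpos : ∀ s, 0 < φ s) : StrictMono (Phi φ) :=
  strictMono_of_deriv_pos fun s => by
    rw [(hasDerivAt_Phi hφ s).deriv]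
    exact mul_pos Real.two_pi_pos (hpos s)

lemma continuous_Phi (hφ : Continuous φ) : Continuous (Phi φ) :=
  continuous_iff_continuousAt.mpr fun s => (hasDerivAt_Phi hφ s).continuousAt

lemma Phi_zero : Phi φ 0 = 0 := by simp [Phi]

lemma Phi_add_period (hφ : Continuous φ) (hper : Function.Periodic φ L)
    (hint : (∫ s in (0 : ℝ)..L, φ s) = 1) (s : ℝ) : Phi φ (s + L) = Phi φ s + 2 * Real.pi := by
  have h1 := hper.intervalIntegral_add_eq 0 s
  rw [zero_add, hint] at h1
  rw [Phi, Phi, ← intervalIntegral.integral_add_adjacent_intervals (hφ.intervalIntegrable 0 s)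
    (hφ.intervalIntegrable s (s + L)), ← h1]
  ring

lemma exists_pos_le_of_periodic (hL : 0 < L) (hφ : Continuous φ) (hper : Function.Periodic φ L)
    (hpos : ∀ s, 0 < φ s) : ∃ m > 0, ∀ s, m ≤ φ s := by
  obtain ⟨s₀, -, hs₀⟩ := isCompact_Icc.exists_isMinOn (nonempty_Icc.mpr hL.le) hφ.continuousOn
  refine ⟨φ s₀, hpos s₀, fun s => ?_⟩
  obtain ⟨y, hy, hsy⟩ := hper.exists_mem_Ico₀ hL s
  rw [hsy]
  exact hs₀ (Ico_subset_Icc_self hy)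

/-- By periodicity `φ` has a positive minimum, so `Φ` grows at least linearly in both directions. -/
lemma surjective_Phi (hL : 0 < L) (hφ : Continuous φ) (hper : Function.Periodic φ L)
    (hpos : ∀ s, 0 < φ s) : Function.Surjective (Phi φ) := by
  obtain ⟨m, hm, hmφ⟩ := exists_pos_le_of_periodic hL hφ hper hpos
  have hgrow : ∀ x y, x ≤ y → 2 * Real.pi * m * (y - x) ≤ Phi φ y - Phi φ x :=
    mul_sub_le_image_sub_of_le_deriv (fun s => (hasDerivAt_Phi hφ s).differentiableAt) fun s => by
      rw [(hasDerivAt_Phi hφ s).deriv]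
      have := Real.pi_pos
      have := hmφ s
      gcongr
  have hc : 0 < 2 * Real.pi * m := mul_pos Real.two_pi_pos hm
  refine (continuous_Phi hφ).surjective ?_ ?_
  · refine tendsto_atTop_mono' _ ?_ (tendsto_id.const_mul_atTop hc)
    filter_upwards [eventually_ge_atTop 0] with s hs
    have := hgrow 0 s hs
    rw [Phi_zero, sub_zero, sub_zero] at this
    exact this
  · refine tendsto_atBot_mono' _ ?_ (tendsto_id.const_mul_atBot hc)
    filter_upwards [eventually_le_atBot 0] with s hs
    have := hgrow s 0 hs
    rw [Phi_zero] at this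
    simp only [id]
    linarith

lemma arclengthOf_Phi (hφ : Continuous φ) (hpos : ∀ s, 0 < φ s) (s : ℝ) :
    arclengthOf φ (Phi φ s) = s :=
  Function.leftInverse_invFun (strictMono_Phi hφ hpos).injective s

lemma Phi_arclengthOf (hL : 0 < L) (hφ : Continuous φ) (hper : Function.Periodic φ L)
    (hpos : ∀ s, 0 < φ s) (t : ℝ) : Phi φ (arclengthOf φ t) = t :=
  Function.rightInverse_invFun (surjective_Phi hL hφ hper hpos) t

lemma hasDerivAt_arclengthOf (hL : 0 < L) (hφ : Continuous φ) (hper : Function.Periodic φ L)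
    (hpos : ∀ s, 0 < φ s) (t : ℝ) :
    HasDerivAt (arclengthOf φ) (2 * Real.pi * φ (arclengthOf φ t))⁻¹ t := by
  have hsurj := surjective_Phi hL hφ hper hpos
  have hcont : Continuous (arclengthOf φ) := by
    have e : arclengthOf φ =
        ((strictMono_Phi hφ hpos).orderIsoOfSurjective _ hsurj).symm := by
      ext t
      obtain ⟨s, rfl⟩ := hsurj t
      rw [arclengthOf_Phi hφ hpos]
      exact (((strictMono_Phi hφ hpos).orderIsoOfSurjective _ hsurj).symm_apply_apply s).symm
    rw [e]
    exact OrderIso.continuous _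
  exact HasDerivAt.of_local_left_inverse hcont.continuousAt (hasDerivAt_Phi hφ _)
    (mul_pos Real.two_pi_pos (hpos _)).ne'
    (Eventually.of_forall (Phi_arclengthOf hL hφ hper hpos))

lemma arclengthOf_add_two_pi (hL : 0 < L) (hφ : Continuous φ) (hper : Function.Periodic φ L)
    (hpos : ∀ s, 0 < φ s) (hint : (∫ s in (0 : ℝ)..L, φ s) = 1) (t : ℝ) :
    arclengthOf φ (t + 2 * Real.pi) = arclengthOf φ t + L := by
  refine (strictMono_Phi hφ hpos).injective ?_
  rw [Phi_add_period hφ hper hint, Phi_arclengthOf hL hφ hper hpos,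
    Phi_arclengthOf hL hφ hper hpos]

/-- The boundary values of `log |f'|` as a function of the angle. -/
noncomputable def logDensity (φ : ℝ → ℝ) (t : ℝ) : ℝ :=
  Real.log (1 / (2 * Real.pi * φ (arclengthOf φ t)))

lemma outerFunction_eq (φ : ℝ → ℝ) (z : ℂ) :
    outerFunction φ z = Complex.exp (schwarzIntegral (logDensity φ) z) := rfl

lemma periodic_logDensity (hL : 0 < L) (hφ : Continuous φ) (hper : Function.Periodic φ L)
    (hpos : ∀ s, 0 < φ s) (hint : (∫ s in (0 : ℝ)..L, φ s) = 1) :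
    Function.Periodic (logDensity φ) (2 * Real.pi) := fun t => by
  rw [logDensity, logDensity, arclengthOf_add_two_pi hL hφ hper hpos hint, hper]

/-- Since `s'(t) = 1/(2πφ)`, the derivative of the density is `-φ'/(2πφ²)` at `s(t)`; the constant
`2π` in the hypothesis is what makes it at most `1` in absolute value. -/
lemma lipschitzWith_logDensity (hL : 0 < L) (hφ : ContDiff ℝ 1 φ) (hper : Function.Periodic φ L)
    (hpos : ∀ s, 0 < φ s)
    (hbound : ∀ s ∈ Icc 0 L, |deriv φ s / φ s ^ 2| ≤ 2 * Real.pi) :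
    LipschitzWith 1 (logDensity φ) := by
  have hb : ∀ s, |deriv φ s / φ s ^ 2| ≤ 2 * Real.pi := by
    have hp : Function.Periodic (fun s => |deriv φ s / φ s ^ 2|) L := fun s => by
      have : deriv φ (s + L) = deriv φ s := by
        rw [← deriv_comp_add_const, hper.funext]
      simp only
      rw [this, hper]
    intro s
    obtain ⟨y, hy, hsy⟩ := hp.exists_mem_Ico₀ hL s
    exact hsy.trans_le (hbound y (Ico_subset_Icc_self hy))
  have hd : ∀ t, HasDerivAt (logDensity φ)
      (-(deriv φ (arclengthOf φ t) / φ (arclengthOf φ t) ^ 2 / (2 * Real.pi))) t := by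
    intro t
    have e : logDensity φ = fun t => -Real.log (2 * Real.pi * φ (arclengthOf φ t)) := by
      ext t
      rw [logDensity, one_div, Real.log_inv]
    have h1 : HasDerivAt φ (deriv φ (arclengthOf φ t)) (arclengthOf φ t) :=
      (hφ.differentiable one_ne_zero _).hasDerivAt
    have h2 := ((h1.comp t (hasDerivAt_arclengthOf hL hφ.continuous hper hpos t)).const_mul
      (2 * Real.pi)).log (mul_pos Real.two_pi_pos (hpos _)).ne'
    rw [e]
    refine h2.neg.congr_deriv ?_
    have := (hpos (arclengthOf φ t)).ne'
    have := Real.pi_ne_zero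
    simp only [Function.comp_apply]
    field_simp
  refine lipschitzWith_of_nnnorm_deriv_le (fun t => (hd t).differentiableAt) fun t => ?_
  rw [← NNReal.coe_le_coe, coe_nnnorm, (hd t).deriv, norm_neg, Real.norm_eq_abs, abs_div,
    abs_of_pos Real.two_pi_pos, div_le_iff₀ Real.two_pi_pos, NNReal.coe_one, one_mul]
  exact hb _

end Arclength

/-! ### The univalent outer function and the conclusion -/

lemma norm_exp_sub_exp_le_of_norm_le {a b : ℂ} {M : ℝ} (ha : ‖a‖ ≤ M) (hb : ‖b‖ ≤ M) :
    ‖Complex.exp b - Complex.exp a‖ ≤ Real.exp M * ‖b - a‖ := by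
  refine (convex_closedBall (0 : ℂ) M).norm_image_sub_le_of_norm_deriv_le
    (fun z _ => Complex.differentiableAt_exp) (fun z hz => ?_) (mem_closedBall_zero_iff.mpr ha)
    (mem_closedBall_zero_iff.mpr hb)
  rw [Complex.deriv_exp, Complex.norm_exp]
  exact Real.exp_le_exp.mpr ((Complex.re_le_norm z).trans (mem_closedBall_zero_iff.mp hz))

/-- The outer function with a `1`-Lipschitz logarithmic density on the circle is the derivative of
a univalent function, smooth up to the boundary. -/
theorem exists_outer_isDiskChart {h : ℝ → ℝ} (hper : Function.Periodic h (2 * Real.pi))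
    (hh : LipschitzWith 1 h) {α : ℝ} (hα0 : 0 < α) (hα1 : α < 1) :
    ∃ F : ℂ → ℂ, EqOn F (fun z => Complex.exp (schwarzIntegral h z)) (Metric.ball 0 1) ∧
      (∀ θ : ℝ, ‖F (Complex.exp (θ * Complex.I))‖ = Real.exp (h θ)) ∧
      IsDiskChart α (fun z => z * segmentMean F 0 z) (segmentMean F) := by
  have hpi := Real.pi_gt_three
  obtain ⟨G, C, hC0, hG, hGS, hGC, hGim, hGre⟩ := exists_extension_schwarzIntegral hper hh hα0 hα1
  obtain ⟨M, hM⟩ := (isCompact_closedBall (0 : ℂ) 1).exists_bound_of_continuousOn hG.continuousOn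
  -- The inequality `1 + π/8 < π/2` amounts to `π > 8/3`.
  have hcos : 0 < Real.cos (1 + Real.pi / 8) :=
    Real.cos_pos_of_mem_Ioo ⟨by linarith, by linarith⟩
  have hEq : EqOn (fun z => Complex.exp (G z)) (fun z => Complex.exp (schwarzIntegral h z))
      (Metric.ball 0 1) := fun z hz => by simp only; rw [hGS hz]
  refine ⟨fun z => Complex.exp (G z), hEq, fun θ => by rw [Complex.norm_exp, hGre],
    isDiskChart_of_le_re (c := Real.exp (-M) * Real.cos (1 + Real.pi / 8))
      (C := Real.exp M * C) (by fun_prop)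
      ((differentiableOn_schwarzIntegral hh.continuous).cexp.congr hEq) (by positivity)
      (fun z hz => ?_) (by positivity) fun z hz w hw => ?_⟩
  · rw [Complex.exp_re]
    have h1 : -M ≤ (G z).re := by
      linarith [(abs_le.mp (Complex.abs_re_le_norm (G z))).1, hM z hz]
    have h2 : Real.cos (1 + Real.pi / 8) ≤ Real.cos (G z).im := by
      rw [← Real.cos_abs (G z).im]
      exact Real.cos_le_cos_of_nonneg_of_le_pi (abs_nonneg _) (by linarith) (hGim z hz)
    exact mul_le_mul (Real.exp_le_exp.mpr h1) h2 hcos.le (Real.exp_pos _).le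
  · rw [mul_assoc]
    exact (norm_exp_sub_exp_le_of_norm_le (hM z hz) (hM w hw)).trans
      (mul_le_mul_of_nonneg_left (hGC z hz w hw) (Real.exp_pos _).le)

lemma eq_of_exp_eq_of_mem_Ico {s t : ℝ} (hs : s ∈ Ico 0 (2 * Real.pi))
    (ht : t ∈ Ico 0 (2 * Real.pi))
    (h : Complex.exp (s * Complex.I) = Complex.exp (t * Complex.I)) : s = t := by
  obtain ⟨n, hn⟩ := Complex.exp_eq_exp_iff_exists_int.mp h
  have hn' : s = t + n * (2 * Real.pi) := by
    have : (s : ℂ) * Complex.I = ((t + n * (2 * Real.pi) : ℝ) : ℂ) * Complex.I := by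
      rw [hn]; push_cast; ring
    exact_mod_cast mul_right_cancel₀ Complex.I_ne_zero this
  have hpi := Real.two_pi_pos
  have h1 : (n : ℝ) < 1 := by
    by_contra! h1
    nlinarith [hs.2, ht.1]
  have h2 : (-1 : ℝ) < n := by
    by_contra! h2
    nlinarith [hs.1, ht.2]
  have h3 : n = 0 := by
    have h1' : n < 1 := by exact_mod_cast h1
    have h2' : -1 < n := by exact_mod_cast h2
    omega
  rw [hn', h3]
  simp

namespace IsDiskChart

variable {α : ℝ≥0} {f : ℂ → ℂ} {A : ℂ → ℂ → ℂ}

theorem isC1HolderDomain (H : IsDiskChart α f A) (hα0 : 0 < α) (hα1 : α < 1) :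
    IsC1HolderDomain α (f '' Metric.ball 0 1) := by
  intro p hp
  rw [H.frontier_image] at hp
  obtain ⟨z, hz, rfl⟩ := hp
  have hz1 := mem_sphere_zero_iff_norm.mp hz
  obtain ⟨δ, η, g, C, hδ, hη, hC, -, hgd, hgC, hg⟩ :=
    H.exists_epigraph (by exact_mod_cast hα0) (by exact_mod_cast hα1.le) hz1
  refine ⟨tangent A z, δ, η, g, Real.toNNReal C, H.norm_tangent hz1, hδ, hη, hgd, ?_, hg⟩
  intro x hx y hy
  rw [edist_dist, edist_dist, ENNReal.ofReal_rpow_of_nonneg dist_nonneg α.coe_nonneg]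
  -- The coercion of `Real.toNNReal C` is `ENNReal.ofReal C` by definition.
  change _ ≤ ENNReal.ofReal C * _
  rw [← ENNReal.ofReal_mul hC]
  exact ENNReal.ofReal_le_ofReal (hgC x hx y hy)

theorem domainClass (H : IsDiskChart α f A) (hα0 : 0 < α) (hα1 : α < 1) :
    DomainClass α (f 0) (f 1) (f '' Metric.ball 0 1) where
  isOpen := H.isOpen_image
  simplyConnected := H.isSimplyConnected_image
  bounded := H.isBounded_image
  regular := H.isC1HolderDomain hα0 hα1
  pole_mem := mem_image_of_mem f (Metric.mem_ball_self one_pos)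
  base_mem := by
    rw [H.frontier_image]
    exact mem_image_of_mem f (by simp)

/-- If `|f'|` on the circle is the reciprocal of `2πφ`, in the arclength determined by `φ`, then
`φ` is the interior normal derivative of the Green's function. -/
theorem forwardOperatorEq (H : IsDiskChart α f A) (hα0 : 0 < α) (hα1 : α < 1) {φ : ℝ → ℝ} {L : ℝ}
    (hL : 0 < L) (hφ : Continuous φ) (hper : Function.Periodic φ L) (hpos : ∀ s, 0 < φ s)
    (hint : (∫ s in (0 : ℝ)..L, φ s) = 1)
    (hA : ∀ s : ℝ, ‖A (Complex.exp (Phi φ s * Complex.I)) (Complex.exp (Phi φ s * Complex.I))‖ =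
      1 / (2 * Real.pi * φ s)) :
    ForwardOperatorEq (f 0) (f 1) (f '' Metric.ball 0 1) L φ := by
  have hα0' : (0 : ℝ) < α := by exact_mod_cast hα0
  have hα1' : (α : ℝ) ≤ 1 := by exact_mod_cast hα1.le
  have hexp : ∀ s : ℝ, ‖Complex.exp (Phi φ s * Complex.I)‖ = 1 := fun s =>
    Complex.norm_exp_ofReal_mul_I _
  have hexpm : ∀ s : ℝ, Complex.exp (Phi φ s * Complex.I) ∈ Metric.closedBall (0 : ℂ) 1 :=
    fun s => mem_closedBall_zero_iff.mpr (hexp s).le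
  set σ : ℝ → ℂ := fun s => f (Complex.exp (Phi φ s * Complex.I)) with hσ
  have htan : ∀ s, tangent A (Complex.exp (Phi φ s * Complex.I)) =
      ((2 * Real.pi * φ s : ℝ) : ℂ) * (Complex.I * Complex.exp (Phi φ s * Complex.I) *
        A (Complex.exp (Phi φ s * Complex.I)) (Complex.exp (Phi φ s * Complex.I))) := fun s => by
    rw [tangent, hA, one_div, Complex.ofReal_inv, div_inv_eq_mul]
    ring
  -- The speed of `σ` is `|f'| Φ' = (1/(2πφ)) · 2πφ = 1`, so its derivative is the unit tangent
  -- itself.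
  have hderiv : ∀ s, HasDerivAt σ (tangent A (Complex.exp (Phi φ s * Complex.I))) s := by
    intro s
    have h1 := (H.hasDerivAt_boundary norm_one (Phi φ s)).scomp s (hasDerivAt_Phi hφ s)
    simp only [one_mul] at h1
    refine h1.congr_deriv ?_
    rw [htan, Complex.real_smul]
  have hΦper := Phi_add_period hφ hper hint
  have hσper : Function.Periodic σ L := fun s => by
    simp only [hσ]
    rw [hΦper]
    exact congrArg f (exp_ofReal_mul_I_periodic (Phi φ s))
  have hPhimem : ∀ s ∈ Ico 0 L, Phi φ s ∈ Ico 0 (2 * Real.pi) := fun s hs => by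
    have h1 := (strictMono_Phi hφ hpos).monotone hs.1
    have h2 := strictMono_Phi hφ hpos hs.2
    have h3 := hΦper 0
    rw [zero_add, Phi_zero, zero_add] at h3
    rw [Phi_zero] at h1
    exact ⟨h1, h2.trans_eq h3⟩
  refine ⟨green f, σ, H.isGreenFunction, ?_, fun s => ?_⟩
  · refine
      { contDiff := ?_
        unitSpeed := fun s => by rw [(hderiv s).deriv]; exact H.norm_tangent (hexp s)
        periodic := hσper
        injOn := fun s hs t ht hst => ?_
        image_eq := ?_
        base := by simp [hσ, Phi_zero]
        left := fun s => by
          rw [(hderiv s).deriv]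
          exact H.eventually_add_normal_mem hα0' hα1' (hexp s) }
    · rw [contDiff_one_iff_deriv]
      refine ⟨fun s => (hderiv s).differentiableAt, ?_⟩
      have e : deriv σ = fun s => ((2 * Real.pi * φ s : ℝ) : ℂ) * (Complex.I *
          Complex.exp (Phi φ s * Complex.I) * A (Complex.exp (Phi φ s * Complex.I))
          (Complex.exp (Phi φ s * Complex.I))) := by
        ext s; rw [(hderiv s).deriv, htan]
      have hc : Continuous fun s => Complex.exp (Phi φ s * Complex.I) := by
        have := continuous_Phi hφ
        fun_prop
      rw [e]
      exact (Complex.continuous_ofReal.comp (continuous_const.mul hφ)).mul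
        ((continuous_const.mul hc).mul (H.continuous.comp (hc.prodMk hc)))
    · have h1 := H.injOn (hexpm s) (hexpm t) hst
      exact (strictMono_Phi hφ hpos).injective
        (eq_of_exp_eq_of_mem_Ico (hPhimem s hs) (hPhimem t ht) h1)
    · rw [H.frontier_image]
      apply subset_antisymm
      · rintro _ ⟨s, -, rfl⟩
        exact mem_image_of_mem f (mem_sphere_zero_iff_norm.mpr (hexp s))
      · rintro _ ⟨z, hz, rfl⟩
        -- The boundary point over `z` has parameter `Φ⁻¹(arg z)`, reduced modulo `L`.
        obtain ⟨s, hs, hsz⟩ := hσper.exists_mem_Ico₀ hL (arclengthOf φ z.arg)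
        refine ⟨s, hs, ?_⟩
        rw [← hsz, hσ]
        simp only
        rw [Phi_arclengthOf hL hφ hper hpos]
        have := Complex.norm_mul_exp_arg_mul_I z
        rw [mem_sphere_zero_iff_norm.mp hz, Complex.ofReal_one, one_mul] at this
        rw [this]
  · rw [(hderiv s).deriv]
    have h1 := H.hasDerivWithinAt_green_normal hα0' hα1' (hexp s)
    rw [hA] at h1
    refine h1.congr_deriv ?_
    have := (hpos s).ne'
    have := Real.pi_ne_zero
    field_simp

end IsDiskChart

theorem theorem2p3 (φ : ℝ → ℝ) (L : ℝ) (α : ℝ≥0)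
    (hα0 : 0 < α) (hα1 : α < 1)
    (hL : 0 < L)
    (hφ : ContDiff ℝ 1 φ)
    (hper : Function.Periodic φ L)
    (hpos : ∀ s, 0 < φ s)
    (hint : (∫ s in (0 : ℝ)..L, φ s) = 1)
    (hbound : ∀ s ∈ Icc 0 L, |deriv φ s / φ s ^ 2| ≤ 2 * Real.pi) :
    0 < poleDistance φ ∧
    ∀ ζc ζb : ℂ, ‖ζb - ζc‖ = poleDistance φ →
      ∃ Ω : Set ℂ, DomainClass α ζc ζb Ω ∧ ForwardOperatorEq ζc ζb Ω L φ := by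
  have hφc := hφ.continuous
  obtain ⟨F, hFeq, hFn, H⟩ := exists_outer_isDiskChart
    (periodic_logDensity hL hφc hper hpos hint) (lipschitzWith_logDensity hL hφ hper hpos hbound)
    (α := α) (by exact_mod_cast hα0) (by exact_mod_cast hα1)
  have h1mem : (1 : ℂ) ∈ Metric.closedBall (0 : ℂ) 1 := by simp
  have h0mem : (0 : ℂ) ∈ Metric.closedBall (0 : ℂ) 1 := by simp
  have hne := H.slope_ne_zero h0mem h1mem
  -- Both are integrals along the radius from `0` to `1`. The endpoint is dropped because `F` is
  -- only known to agree with `outerFunction φ` in the open disk.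
  have hdist : poleDistance φ = ‖segmentMean F 0 1‖ := by
    rw [poleDistance, segmentMean, intervalIntegral.integral_of_le zero_le_one,
      intervalIntegral.integral_of_le zero_le_one, integral_Ioc_eq_integral_Ioo,
      integral_Ioc_eq_integral_Ioo]
    congr 1
    refine setIntegral_congr_fun measurableSet_Ioo fun t ht => ?_
    have hmem : (t : ℂ) ∈ Metric.ball (0 : ℂ) 1 := by
      rw [mem_ball_zero_iff, Complex.norm_real, Real.norm_eq_abs, abs_of_pos ht.1]
      exact ht.2
    simp only [sub_zero, mul_one, zero_add]
    rw [hFeq hmem, outerFunction_eq]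
  refine ⟨hdist ▸ norm_pos_iff.mpr hne, fun ζc ζb hζ => ?_⟩
  -- The rotation that carries `f 1 - f 0` to `ζb - ζc`; it is unimodular exactly because of the
  -- prescribed distance, and it leaves `|f'|` unchanged.
  set κ : ℂ := (ζb - ζc) / segmentMean F 0 1 with hκ
  have hκ1 : ‖κ‖ = 1 := by rw [hκ, norm_div, hζ, hdist, div_self (norm_ne_zero_iff.mpr hne)]
  have H' := H.affine ζc hκ1
  have hb : ζc + κ * (1 * segmentMean F 0 1) = ζb := by
    rw [one_mul, hκ, div_mul_cancel₀ _ hne, add_sub_cancel]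
  have hc : ζc + κ * (0 * segmentMean F 0 0) = ζc := by rw [zero_mul, mul_zero, add_zero]
  have hdom := H'.domainClass hα0 hα1
  have hfwd := H'.forwardOperatorEq hα0 hα1 hL hφc hper hpos hint fun s => by
    rw [segmentMean_self, norm_mul, hκ1, one_mul, hFn, logDensity, arclengthOf_Phi hφc hpos,
      Real.exp_log (by have := hpos s; have := Real.pi_pos; positivity)]
  simp only [hb, hc] at hdom hfwd
  exact ⟨_, hdom, hfwd⟩
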